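/- Let $\mathbf Y=\boldsymbol\theta+\boldsymbol\varepsilon\in\mathbb R^n$, where $\varepsilon_1,\dots,\varepsilon_n$ are independent mean-zero random variables with $\mathbb E[e^{s\varepsilon_i}]\le e^{s^2/2}$ for all $s\in\mathbb R$, and where $\boldsymbol\theta$ has exactly $K$ change-points: there are integers $1=\tau^*_0<\tau^*_1<\dots<\tau^*_K<\tau^*_{K+1}=n+1$ and reals $\mu_1,\dots,\mu_{K+1}$ with $\mu_k\neq\mu_{k+1}$ such that $\theta_i=\mu_k$ for $\tau^*_{k-1}\le i<\tau^*_k$. Put $\Delta_k=\mu_{k+1}-\mu_k$. For integers $1\le t_1<t_2<t_3\le n+1$, $\mathbf t=(t_1,t_2,t_3)$, and $x\in\mathbb R^n$ let $$\mathbf C(x,\mathbf t)=\Big[\tfrac{1}{t_3-t_2}\sum_{i=t_2}^{t_3-1}x_i-\tfrac1{t_2-t_1}\sum_{i=t_1}^{t_2-1}x_i\Big]\sqrt{\tfrac{(t_2-t_1)(t_3-t_2)}{t_3-t_1}},\qquad \psi_q(\mathbf t)=\sqrt{2\log\tfrac{n(t_3-t_1)}{(t_3-t_2)(t_2-t_1)}+q},$$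 and $\mathbf E(\boldsymbol\theta,\mathbf t)=|\mathbf C(\boldsymbol\theta,\mathbf t)|$. A change-point vector is $\boldsymbol\tau=(\tau_1<\dots<\tau_m)$ with entries in $\{2,\dots,n\}$, $m=|\boldsymbol\tau|\ge 0$, with the conventions $\tau_0=1$, $\tau_{m+1}=n+1$. An entry $\tau_l$ of $\boldsymbol\tau$ is called $(\kappa,q,\boldsymbol\tau)$-high-energy if $\mathbf E(\boldsymbol\theta,\mathbf t)>\kappa\,\psi_q(\mathbf t)$ for $\mathbf t=(\tau_{l-1},\tau_l,\tau_{l+1})$; a $(\kappa,q,\boldsymbol\tau^*)$-high-energy change-point $\tau^*_k$ is simply called $(\kappa,q)$-high-energy. For $L,q>0$, let $\widehat{\boldsymbol\tau}$ be any minimizer, over all change-point vectors $\boldsymbol\tau$, of $$\|\mathbf Y-\Pi_{\boldsymbol\tau}\mathbf Y\|^2+L\,\mathrm{pen}_0(\boldsymbol\tau,q),\qquad \mathrm{pen}_0(\boldsymbol\tau,q)=q|\boldsymbol\tau|+2\sum_{i=1}^{|\boldsymbol\tau|+1}\log\frac{n}{\tau_i-\tau_{i-1}},$$ where $\Pi_{\boldsymbol\tau}$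 is the orthogonal projection onto the vectors that are constant on each $\{\tau_i,\dots,\tau_{i+1}-1\}$, $0\le i\le|\boldsymbol\tau|$. Let $$\mathcal A_q=\big\{|\mathbf C(\boldsymbol\varepsilon,\mathbf t)|\le 2\psi_q(\mathbf t)\ \text{ for all } 1\le t_1<t_2<t_3\le n+1\big\}.$$ **Proposition 4.** There exist universal constants $c,c'>0$, $L_0$, $q_0$, $n_0$ and, for every $L\ge L_0$, a constant $\kappa_L>1$ depending only on $L$, such that for all $L\ge L_0$, $q>q_0$, $n>n_0$, $K\geq 1$ and all $\boldsymbol\theta\in\mathbb R^n$ with exactly $K$ change-points (with no condition on their energies), the event $\mathcal A_q$ has probability at least $1-ce^{-c'q}$, and on $\mathcal A_q$ every such $\widehat{\boldsymbol\tau}$ satisfies: (a) (NoSp) for each $k\in\{1,\dots,K\}$, at most one entry of $\widehat{\boldsymbol\tau}$ lies in the interval $\big(\tfrac{\tau^*_{k-1}+\tau^*_k}2,\tfrac{\tau^*_k+\tau^*_{k+1}}2\big]$, where for $k=1$ the left end is replaced by the closed end $2$ and for $k=K$ the right end is replaced by $n$ (so that the interval is $[2,n]$ if $K=1$); (b) (Detec)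 for each $k\in\{1,\dots,K\}$ such that $\tau^*_k$ is a $(\kappa_L,q)$-high-energy change-point, $\widehat{\boldsymbol\tau}$ is non-empty and $$\min_{l}|\widehat\tau_l-\tau^*_k|\le\min\Big\{\tfrac{\tau^*_{k+1}-\tau^*_k}2,\ \tfrac{\tau^*_k-\tau^*_{k-1}}2,\ \kappa_L\tfrac{\log(n\Delta_k^2)+q}{\Delta_k^2}\Big\};$$ (c) for each $k\in\{1,\dots,K\}$, either $\tau^*_k$ is an entry of $\widehat{\boldsymbol\tau}$, or $\tau^*_k$ is not a $(\sqrt L+2,\,q,\,\widehat{\boldsymbol\tau}^{(k)})$-high-energy change-point, where $\widehat{\boldsymbol\tau}^{(k)}$ is the change-point vector obtained by inserting $\tau^*_k$ into $\widehat{\boldsymbol\tau}$. -/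

import Mathlib

open MeasureTheory ProbabilityTheory

noncomputable section

namespace ChangePoint

/-- Sum of the coordinates of `x` at times `a, a+1, …, b-1`; the times are `1, …, n`, and the
coordinate `i : Fin n` is the observation at time `i + 1`. -/
def segSum {n : ℕ} (x : Fin n → ℝ) (a b : ℕ) : ℝ :=
  ∑ i ∈ Finset.univ.filter (fun i : Fin n => a ≤ (i : ℕ) + 1 ∧ (i : ℕ) + 1 < b), x i

/-- The CUSUM statistic of `x` at the triad `(t₁, t₂, t₃)`: the weighted difference of the means of
`x` on `[t₂, t₃)` and on `[t₁, t₂)`. -/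
def cusum {n : ℕ} (x : Fin n → ℝ) (t₁ t₂ t₃ : ℕ) : ℝ :=
  (segSum x t₂ t₃ / ((t₃ : ℝ) - t₂) - segSum x t₁ t₂ / ((t₂ : ℝ) - t₁)) *
    √(((t₂ : ℝ) - t₁) * ((t₃ : ℝ) - t₂) / ((t₃ : ℝ) - t₁))

/-- The energy of `θ` at the triad `(t₁, t₂, t₃)`. -/
def energy {n : ℕ} (θ : Fin n → ℝ) (t₁ t₂ t₃ : ℕ) : ℝ := |cusum θ t₁ t₂ t₃|

/-- The multiscale threshold `√(2 log (n (t₃ - t₁) / ((t₃ - t₂) (t₂ - t₁))) + q)`. -/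
def threshold (n : ℕ) (q : ℝ) (t₁ t₂ t₃ : ℕ) : ℝ :=
  √(2 * Real.log ((n : ℝ) * ((t₃ : ℝ) - t₁) / (((t₃ : ℝ) - t₂) * ((t₂ : ℝ) - t₁))) + q)

/-- The middle point of the triad `(t₁, t₂, t₃)` has `(κ, q)`-high energy. -/
def IsHighEnergy {n : ℕ} (θ : Fin n → ℝ) (κ q : ℝ) (t₁ t₂ t₃ : ℕ) : Prop :=
  κ * threshold n q t₁ t₂ t₃ < energy θ t₁ t₂ t₃

/-- `θ` is the vector with exactly `K` change-points, at `τ 1 < ⋯ < τ K`, with the conventions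
`τ 0 = 1` and `τ (K + 1) = n + 1`; it takes the value `μ k` on `[τ (k - 1), τ k)`, and consecutive
values are distinct. Only `τ 0, …, τ (K + 1)` and `μ 1, …, μ (K + 1)` matter. -/
structure HasChangePoints {n : ℕ} (θ : Fin n → ℝ) (K : ℕ) (τ : ℕ → ℕ) (μ : ℕ → ℝ) : Prop where
  first : τ 0 = 1
  last : τ (K + 1) = n + 1
  lt_succ : ∀ k ≤ K, τ k < τ (k + 1)
  ne_succ : ∀ k ∈ Finset.Icc 1 K, μ k ≠ μ (k + 1)
  value : ∀ k ∈ Finset.Icc 1 (K + 1), ∀ i : Fin n,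
    τ (k - 1) ≤ (i : ℕ) + 1 → (i : ℕ) + 1 < τ k → θ i = μ k

/-! A change-point vector `1 < τ₁ < ⋯ < τ_m < n + 1` is represented by the set of its entries, a
subset of `{2, …, n}`, with the conventions `τ₀ = 1` and `τ_{m+1} = n + 1`. -/

/-- The element of `{1} ∪ τ` that precedes `t` (for `1 < t`). -/
def prevPoint (τ : Finset ℕ) (t : ℕ) : ℕ := ((insert 1 τ).filter (· < t)).sup id

/-- The element of `τ ∪ {n + 1}` that follows `t` (for `t ≤ n`). -/
def nextPoint (n : ℕ) (τ : Finset ℕ) (t : ℕ) : ℕ := sInf {u | u ∈ insert (n + 1) τ ∧ t < u}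

/-- The entry `t` of the change-point vector `τ` is a `(κ, q, τ)`-high-energy change-point. -/
def IsHighEnergyIn {n : ℕ} (θ : Fin n → ℝ) (κ q : ℝ) (τ : Finset ℕ) (t : ℕ) : Prop :=
  IsHighEnergy θ κ q (prevPoint τ t) t (nextPoint n τ t)

/-- The space of vectors that are constant on each segment `[τ_i, τ_{i+1})`, `0 ≤ i ≤ |τ|`. -/
def piecewiseConst (n : ℕ) (τ : Finset ℕ) : Submodule ℝ (EuclideanSpace ℝ (Fin n)) where
  carrier := {x | ∀ a ∈ insert 1 τ, ∀ i j : Fin n,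
    a ≤ (i : ℕ) + 1 → (i : ℕ) + 1 < nextPoint n τ a →
    a ≤ (j : ℕ) + 1 → (j : ℕ) + 1 < nextPoint n τ a → x i = x j}
  add_mem' := by
    intro x y hx hy a ha i j h1 h2 h3 h4
    simp only [PiLp.add_apply, hx a ha i j h1 h2 h3 h4, hy a ha i j h1 h2 h3 h4]
  zero_mem' := by
    intro a ha i j h1 h2 h3 h4
    rfl
  smul_mem' := by
    intro r x hx a ha i j h1 h2 h3 h4
    simp only [PiLp.smul_apply, hx a ha i j h1 h2 h3 h4]

/-- The multiscale penalty `q |τ| + 2 ∑ log (n / (τ_{i+1} - τ_i))`, the sum over the `|τ| + 1`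
segments of `τ`. -/
def pen (n : ℕ) (q : ℝ) (τ : Finset ℕ) : ℝ :=
  q * (τ.card : ℝ) + 2 * ∑ a ∈ insert 1 τ, Real.log ((n : ℝ) / ((nextPoint n τ a : ℝ) - a))

/-- The penalized least-squares criterion `‖Y - Π_τ Y‖² + L pen(τ, q)`, where `Π_τ` is the
orthogonal projection onto `piecewiseConst n τ`. -/
def crit {n : ℕ} (L q : ℝ) (Y : Fin n → ℝ) (τ : Finset ℕ) : ℝ :=
  ‖WithLp.toLp 2 Y - (piecewiseConst n τ).starProjection (WithLp.toLp 2 Y)‖ ^ 2 + L * pen n q τ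

/-- `τ` is a penalized least-squares estimate: a minimizer of the criterion over all change-point
vectors. -/
def IsPenalizedLSE {n : ℕ} (L q : ℝ) (Y : Fin n → ℝ) (τ : Finset ℕ) : Prop :=
  τ ⊆ Finset.Icc 2 n ∧ ∀ τ' ⊆ Finset.Icc 2 n, crit L q Y τ ≤ crit L q Y τ'

/-- The noise model: independent, mean-zero random variables with
`𝔼[exp (s ε_i)] ≤ exp (s² / 2)` for all real `s`. -/
structure IsNoise {Ω : Type*} [MeasurableSpace Ω] (P : Measure Ω) {n : ℕ}
    (ε : Fin n → Ω → ℝ) : Prop where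
  measurable : ∀ i, Measurable (ε i)
  indep : iIndepFun ε P
  mean_zero : ∀ i, ∫ ω, ε i ω ∂P = 0
  subgaussian : ∀ i, HasSubgaussianMGF (ε i) 1 P

/-- The event on which the noise is uniformly controlled over all triads
`1 ≤ t₁ < t₂ < t₃ ≤ n + 1`. -/
def noiseEvent {Ω : Type*} {n : ℕ} (ε : Fin n → Ω → ℝ) (q : ℝ) : Set Ω :=
  {ω | ∀ t₁ t₂ t₃ : ℕ, 1 ≤ t₁ → t₁ < t₂ → t₂ < t₃ → t₃ ≤ n + 1 →
    |cusum (fun i => ε i ω) t₁ t₂ t₃| ≤ 2 * threshold n q t₁ t₂ t₃}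

/-- No spurious change-point: for each `k`, the cell
`((τ*_{k-1} + τ*_k) / 2, (τ*_k + τ*_{k+1}) / 2]` contains at most one point of `τ`; the first cell
is extended on the left to `2`, and the last one on the right to `n`, so that the cells cover
`{2, …, n}`. -/
def NoSp (K : ℕ) (τs : ℕ → ℕ) (τ : Finset ℕ) : Prop :=
  ∀ k ∈ Finset.Icc 1 K,
    {u ∈ (τ : Set ℕ) | (k = 1 ∨ ((τs (k - 1) : ℝ) + τs k) / 2 < u) ∧
      (k = K ∨ (u : ℝ) ≤ ((τs k : ℝ) + τs (k + 1)) / 2)}.ncard ≤ 1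

/-- Every `(κ, q)`-high-energy change-point `τ*_k`, of height `Δ_k = μ_{k+1} - μ_k`, is at distance
at most `min ((τ*_{k+1} - τ*_k) / 2) ((τ*_k - τ*_{k-1}) / 2) (c (log (n Δ_k²) + q) / Δ_k²)` from the
set `τ`. Since `τ` is finite, this says that some point of `τ` is within that distance; in
particular `τ` is not empty. -/
def Detec {n : ℕ} (θ : Fin n → ℝ) (K : ℕ) (τs : ℕ → ℕ) (μ : ℕ → ℝ) (κ q c : ℝ)
    (τ : Finset ℕ) : Prop :=
  ∀ k ∈ Finset.Icc 1 K, IsHighEnergy θ κ q (τs (k - 1)) (τs k) (τs (k + 1)) →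
    ∃ t ∈ τ, |(t : ℝ) - τs k| ≤
      min (((τs (k + 1) : ℝ) - τs k) / 2)
        (min (((τs k : ℝ) - τs (k - 1)) / 2)
          (c * (Real.log (n * (μ (k + 1) - μ k) ^ 2) + q) / (μ (k + 1) - μ k) ^ 2))

end ChangePoint

end

open MeasureTheory ProbabilityTheory

noncomputable section

namespace ChangePoint

/-! ### Sums over segments -/

/-! Everything rests on one identity. Cutting a segment at a point lowers the residual sum of
squares by the squared CUSUM statistic of `Y` there (`norm_sub_starProjection_insert`) and raises
the penalty by exactly the squared threshold (`pen_insert`). Up to a constant the criterion is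
therefore a sum of segment costs (`segCost_add_segCost`, `crit_insert`), and a minimizer satisfies
exchange inequalities: between two of its points no other list of points is cheaper
(`IsPenalizedLSE.chainCost_le`). Each deterministic claim comes from such exchanges. On the noise
event the noise is negligible against `√L` times the threshold because `L` is large, and bounded
changes of the logarithms are absorbed by the large `q`.

No spurious points. Let `a < b` be consecutive estimated points in the cell of a jump `s`, between
the neighbouring jumps `v` and `w`. If the point `t₁` before `a` is not to the left of `v` and no
jump lies in `(t₁, b)`, the statistic at `a` is pure noise and `a` should be removed. If `t₁ < v`,
the statistic at `a` is contaminated by what happens before `v`. It is then a combination of a clean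
statistic on `[v, b)` and of the statistic `e` at `v` in `[t₁, a)` (`cusum_left`). If `e` is small,
removing `a` pays; if `e` is large, moving `a` to `v` pays (`gain_pos`). This excludes `b ≤ s` and,
by symmetry, `s ≤ a`. If `a < s < b` with `s` very close to one of the two, the jump has bounded
energy because `s` was not selected, so it barely biases the statistic at the other point and the
same argument applies. If the two distances are comparable, `s` is inserted while `a` and `b` are
both removed or moved; the gains on the two sides exceed the cost of `s`, except in one
configuration where the jump has low energy and moving `a`, `b` to `v`, `w` without inserting `s`
wins (`false_of_jump_between`).

Detection. If no estimated point is within `d` of a jump, one can insert the jump and up to two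
auxiliary points, all new segments being at least about `d` long. Optimality then bounds the energy
of the jump at scale `d` (`mul_sq_jump_le`), and the radius in the claim is chosen to violate this
bound. Claim (c) is the same inequality for the jump alone, with the noise added back
(`not_isHighEnergyIn_of_isPenalizedLSE`).

Probability. A union bound is taken over unions of at most `2 ^ 18` adjacent dyadic segments, so
only about `n / 2 ^ j` positions occur at level `j`, each failing with probability of order `(n / 2
^ j) ^ (-3/2) * exp (-3 q / 4)`. Chaining extends the control to all segments
(`GridBound.abs_segSum_le`) and hence to all CUSUM statistics (`GridBound.noiseBound`). -/

theorem segSum_self {n : ℕ} (x : Fin n → ℝ) (a : ℕ) : segSum x a a = 0 := by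
  unfold segSum
  rw [Finset.filter_false_of_mem (by intro i _; omega), Finset.sum_empty]

theorem segSum_add_segSum {n : ℕ} (x : Fin n → ℝ) {a b c : ℕ} (hab : a ≤ b) (hbc : b ≤ c) :
    segSum x a b + segSum x b c = segSum x a c := by
  unfold segSum
  rw [← Finset.sum_union]
  · congr 1
    ext i
    simp only [Finset.mem_union, Finset.mem_filter, Finset.mem_univ, true_and]
    omega
  · rw [Finset.disjoint_left]
    intro i
    simp only [Finset.mem_filter, Finset.mem_univ, true_and]
    omega

theorem segSum_add {n : ℕ} (x y : Fin n → ℝ) (a b : ℕ) :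
    segSum (fun i => x i + y i) a b = segSum x a b + segSum y a b := by
  unfold segSum
  exact Finset.sum_add_distrib

theorem card_segment {n : ℕ} {a b : ℕ} (ha : 1 ≤ a) (hb : b ≤ n + 1) :
    (Finset.univ.filter (fun i : Fin n => a ≤ (i : ℕ) + 1 ∧ (i : ℕ) + 1 < b)).card = b - a := by
  rw [← Nat.card_Ico]
  refine Finset.card_bij (fun i _ => (i : ℕ) + 1) ?_ ?_ ?_
  · intro i hi
    simpa using hi
  · intro i _ j _ h
    exact Fin.ext (by simpa using h)
  · intro k hk
    rw [Finset.mem_Ico] at hk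
    refine ⟨⟨k - 1, by omega⟩, ?_, ?_⟩
    · simp only [Finset.mem_filter, Finset.mem_univ, true_and]
      omega
    · change k - 1 + 1 = k
      omega

theorem segSum_eq_of_const {n : ℕ} (x : Fin n → ℝ) (r : ℝ) {a b : ℕ} (ha : 1 ≤ a) (hab : a ≤ b)
    (hb : b ≤ n + 1)
    (hx : ∀ i : Fin n, a ≤ (i : ℕ) + 1 → (i : ℕ) + 1 < b → x i = r) :
    segSum x a b = ((b : ℝ) - a) * r := by
  unfold segSum
  rw [Finset.sum_congr rfl (g := fun _ => r), Finset.sum_const, card_segment ha hb, nsmul_eq_mul,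
    Nat.cast_sub hab]
  intro i hi
  simp only [Finset.mem_filter, Finset.mem_univ, true_and] at hi
  exact hx i hi.1 hi.2

theorem cusum_add {n : ℕ} (x y : Fin n → ℝ) (t₁ t₂ t₃ : ℕ) :
    cusum (fun i => x i + y i) t₁ t₂ t₃ = cusum x t₁ t₂ t₃ + cusum y t₁ t₂ t₃ := by
  unfold cusum
  rw [segSum_add, segSum_add]
  ring

theorem cusum_eq_zero_of_const {n : ℕ} (x : Fin n → ℝ) (r : ℝ) {t₁ t₂ t₃ : ℕ} (h₁ : 1 ≤ t₁)
    (h₁₂ : t₁ < t₂) (h₂₃ : t₂ < t₃) (h₃ : t₃ ≤ n + 1)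
    (hx : ∀ i : Fin n, t₁ ≤ (i : ℕ) + 1 → (i : ℕ) + 1 < t₃ → x i = r) :
    cusum x t₁ t₂ t₃ = 0 := by
  have h12 : (0 : ℝ) < (t₂ : ℝ) - t₁ := by simpa using h₁₂
  have h23 : (0 : ℝ) < (t₃ : ℝ) - t₂ := by simpa using h₂₃
  unfold cusum
  rw [segSum_eq_of_const x r h₁ h₁₂.le (by omega) (fun i hi hi' => hx i hi (by omega)),
    segSum_eq_of_const x r (by omega) h₂₃.le h₃ (fun i hi hi' => hx i (by omega) hi')]
  rw [mul_div_cancel_left₀ _ h12.ne', mul_div_cancel_left₀ _ h23.ne', sub_self, zero_mul]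

/-! ### Consecutive points of a change-point vector -/

/-- `u < w` are consecutive points of `{1} ∪ τ ∪ {n + 1}`. -/
structure Consec (n : ℕ) (τ : Finset ℕ) (u w : ℕ) : Prop where
  left : u ∈ insert 1 τ
  right : w ∈ insert (n + 1) τ
  lt : u < w
  gap : ∀ x ∈ τ, u < x → w ≤ x

namespace Consec

variable {n : ℕ} {τ : Finset ℕ} {u w t : ℕ}

theorem one_le (hτ : τ ⊆ Finset.Icc 2 n) (h : Consec n τ u w) : 1 ≤ u := by
  rcases Finset.mem_insert.1 h.left with h | h
  · omega
  · have := Finset.mem_Icc.1 (hτ h)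
    omega

theorem le_succ (hτ : τ ⊆ Finset.Icc 2 n) (h : Consec n τ u w) : w ≤ n + 1 := by
  rcases Finset.mem_insert.1 h.right with h | h
  · omega
  · have := Finset.mem_Icc.1 (hτ h)
    omega

theorem nextPoint_eq (hτ : τ ⊆ Finset.Icc 2 n) (h : Consec n τ u w) : nextPoint n τ u = w := by
  unfold nextPoint
  refine le_antisymm (Nat.sInf_le ⟨h.right, h.lt⟩) ?_
  refine le_csInf ⟨w, h.right, h.lt⟩ ?_
  rintro x ⟨hx, hux⟩
  rcases Finset.mem_insert.1 hx with rfl | hx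
  · exact h.le_succ hτ
  · exact h.gap x hx hux

theorem insert_of_notMem (h : Consec n τ u w) (ht : ¬ (u < t ∧ t < w)) :
    Consec n (insert t τ) u w where
  left := by
    have := h.left
    simp only [Finset.mem_insert] at this ⊢
    tauto
  right := by
    have := h.right
    simp only [Finset.mem_insert] at this ⊢
    tauto
  lt := h.lt
  gap x hx hux := by
    rcases Finset.mem_insert.1 hx with rfl | hx
    · omega
    · exact h.gap x hx hux

theorem insert_left (h : Consec n τ u w) (hu : u < t) (hw : t < w) :
    Consec n (insert t τ) u t where
  left := by
    have := h.left
    simp only [Finset.mem_insert] at this ⊢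
    tauto
  right := by simp
  lt := hu
  gap x hx hux := by
    rcases Finset.mem_insert.1 hx with rfl | hx
    · exact le_rfl
    · exact hw.le.trans (h.gap x hx hux)

theorem insert_right (h : Consec n τ u w) (hu : u < t) (hw : t < w) :
    Consec n (insert t τ) t w where
  left := by simp
  right := by
    have := h.right
    simp only [Finset.mem_insert] at this ⊢
    tauto
  lt := hw
  gap x hx hux := by
    rcases Finset.mem_insert.1 hx with rfl | hx
    · omega
    · exact h.gap x hx (by omega)

theorem mem_Icc (hτ : τ ⊆ Finset.Icc 2 n) (h : Consec n τ u w) (hu : u < t) (hw : t < w) :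
    t ∈ Finset.Icc 2 n := by
  have h1 := h.one_le hτ
  have h2 := h.le_succ hτ
  rw [Finset.mem_Icc]
  omega

theorem notMem (h : Consec n τ u w) (hu : u < t) (hw : t < w) : t ∉ τ := fun ht => by
  have := h.gap t ht hu
  omega

theorem prevPoint_eq (hτ : τ ⊆ Finset.Icc 2 n) (h : Consec n τ u w) (hu : u < t) (hw : t ≤ w) :
    prevPoint τ t = u := by
  unfold prevPoint
  refine le_antisymm (Finset.sup_le ?_) ?_
  · intro x hx
    rw [Finset.mem_filter] at hx
    by_contra hlt
    have hlt : u < x := not_le.1 hlt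
    rcases Finset.mem_insert.1 hx.1 with rfl | hx'
    · have := h.one_le hτ
      omega
    · have := h.gap x hx' hlt
      omega
  · exact Finset.le_sup (f := id) (Finset.mem_filter.2 ⟨h.left, hu⟩)

end Consec

/-- Every starting point of a segment is followed by its `nextPoint`. -/
theorem consec_nextPoint {n : ℕ} {τ : Finset ℕ} {a : ℕ} (hn : 1 ≤ n) (hτ : τ ⊆ Finset.Icc 2 n)
    (ha : a ∈ insert 1 τ) : Consec n τ a (nextPoint n τ a) := by
  have han : a < n + 1 := by
    rcases Finset.mem_insert.1 ha with h | h
    · omega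
    · have := Finset.mem_Icc.1 (hτ h)
      omega
  have hne : {u | u ∈ insert (n + 1) τ ∧ a < u}.Nonempty := ⟨n + 1, by simp, han⟩
  have hmem := Nat.sInf_mem hne
  exact ⟨ha, hmem.1, hmem.2, fun x hx hax => Nat.sInf_le ⟨by simp [hx], hax⟩⟩

/-- Every time between `2` and `n` that is not a point of `τ` lies strictly between two consecutive
points. -/
theorem exists_consec {n : ℕ} {τ : Finset ℕ} {t : ℕ} (hτ : τ ⊆ Finset.Icc 2 n)
    (ht : t ∈ Finset.Icc 2 n) (htτ : t ∉ τ) : ∃ u w, Consec n τ u w ∧ u < t ∧ t < w := by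
  rw [Finset.mem_Icc] at ht
  have hne : ((insert 1 τ).filter (· < t)).Nonempty :=
    ⟨1, Finset.mem_filter.2 ⟨by simp, by omega⟩⟩
  have hu := Finset.mem_filter.1 (Finset.max'_mem _ hne)
  set u := ((insert 1 τ).filter (· < t)).max' hne with hu_def
  have hc := consec_nextPoint (by omega) hτ hu.1
  refine ⟨u, nextPoint n τ u, hc, hu.2, ?_⟩
  by_contra hle
  have hle := not_lt.1 hle
  rcases Finset.mem_insert.1 hc.right with h | h
  · omega
  · have hlt : nextPoint n τ u < t := lt_of_le_of_ne hle (fun h' => htτ (h' ▸ h))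
    have := Finset.le_max' ((insert 1 τ).filter (· < t)) _
      (Finset.mem_filter.2 ⟨Finset.mem_insert_of_mem h, hlt⟩)
    have := hc.lt
    omega

/-- Every point of `τ` has a predecessor. -/
theorem exists_consec_left {n : ℕ} {τ : Finset ℕ} {t : ℕ} (hτ : τ ⊆ Finset.Icc 2 n)
    (ht : t ∈ τ) : ∃ u, Consec n τ u t := by
  have ht2 := Finset.mem_Icc.1 (hτ ht)
  have hne : ((insert 1 τ).filter (· < t)).Nonempty :=
    ⟨1, Finset.mem_filter.2 ⟨by simp, by omega⟩⟩
  have hu := Finset.mem_filter.1 (Finset.max'_mem _ hne)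
  refine ⟨_, hu.1, by simp [ht], hu.2, fun x hx hux => ?_⟩
  by_contra hle
  have := Finset.le_max' ((insert 1 τ).filter (· < t)) _
    (Finset.mem_filter.2 ⟨Finset.mem_insert_of_mem hx, not_le.1 hle⟩)
  omega

/-! ### Effect of one insertion on the criterion -/

section Insert

variable {n : ℕ} {τ : Finset ℕ} {t₁ t t₃ : ℕ}

/-- The new point falls in the segment that starts at `t₁`, and segments do not overlap, so no other
starting point sees it as its successor. -/
theorem nextPoint_insert_of_ne (hn : 1 ≤ n) (hτ : τ ⊆ Finset.Icc 2 n) (h : Consec n τ t₁ t₃)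
    (h₁ : t₁ < t) (h₃ : t < t₃) {a : ℕ} (ha : a ∈ insert 1 τ) (hne : a ≠ t₁) :
    nextPoint n (insert t τ) a = nextPoint n τ a := by
  have hc := consec_nextPoint hn hτ ha
  have hτ' : insert t τ ⊆ Finset.Icc 2 n := Finset.insert_subset (h.mem_Icc hτ h₁ h₃) hτ
  refine (hc.insert_of_notMem ?_).nextPoint_eq hτ'
  rintro ⟨hat, hta⟩
  rcases lt_or_gt_of_ne hne with hlt | hgt
  · rcases Finset.mem_insert.1 h.left with h' | h'
    · have := hc.one_le hτ
      omega
    · have := hc.gap _ h' hlt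
      omega
  · rcases Finset.mem_insert.1 ha with h' | h'
    · have := h.one_le hτ
      omega
    · have := h.gap _ h' hgt
      omega

theorem pen_insert (q : ℝ) (hτ : τ ⊆ Finset.Icc 2 n) (h : Consec n τ t₁ t₃) (h₁ : t₁ < t)
    (h₃ : t < t₃) :
    pen n q (insert t τ) = pen n q τ + q + 2 * Real.log ((n : ℝ) / ((t : ℝ) - t₁)) +
      2 * Real.log ((n : ℝ) / ((t₃ : ℝ) - t)) - 2 * Real.log ((n : ℝ) / ((t₃ : ℝ) - t₁)) := by
  have hmem := h.mem_Icc hτ h₁ h₃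
  have hn : 1 ≤ n := by
    have := Finset.mem_Icc.1 hmem
    omega
  have hτ' : insert t τ ⊆ Finset.Icc 2 n := Finset.insert_subset hmem hτ
  have htτ := h.notMem h₁ h₃
  have ht1 : t ∉ insert 1 τ := by
    rw [Finset.mem_insert, not_or]
    exact ⟨by have := Finset.mem_Icc.1 hmem; omega, htτ⟩
  unfold pen
  rw [Finset.card_insert_of_notMem htτ, Finset.insert_comm, Finset.sum_insert ht1,
    (h.insert_right h₁ h₃).nextPoint_eq hτ', ← Finset.add_sum_erase _ _ h.left,
    ← Finset.add_sum_erase (insert 1 τ) _ h.left, (h.insert_left h₁ h₃).nextPoint_eq hτ',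
    h.nextPoint_eq hτ]
  have : ∑ a ∈ (insert 1 τ).erase t₁,
        Real.log ((n : ℝ) / ((nextPoint n (insert t τ) a : ℝ) - a)) =
      ∑ a ∈ (insert 1 τ).erase t₁, Real.log ((n : ℝ) / ((nextPoint n τ a : ℝ) - a)) := by
    refine Finset.sum_congr rfl fun a ha => ?_
    rw [Finset.mem_erase] at ha
    rw [nextPoint_insert_of_ne hn hτ h h₁ h₃ ha.2 ha.1]
  rw [this]
  push_cast
  ring

theorem mem_piecewiseConst_iff (hn : 1 ≤ n) (hτ : τ ⊆ Finset.Icc 2 n)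
    (x : EuclideanSpace ℝ (Fin n)) :
    x ∈ piecewiseConst n τ ↔ ∀ u w, Consec n τ u w → ∀ i j : Fin n,
      u ≤ (i : ℕ) + 1 → (i : ℕ) + 1 < w → u ≤ (j : ℕ) + 1 → (j : ℕ) + 1 < w → x i = x j := by
  constructor
  · intro hx u w huw i j h1 h2 h3 h4
    have := huw.nextPoint_eq hτ
    exact hx u huw.left i j h1 (by omega) h3 (by omega)
  · intro hx a ha
    exact hx a _ (consec_nextPoint hn hτ ha)

/-- Consecutive points after an insertion are consecutive points before it, or one of the two new
pairs. -/
theorem Consec.of_insert (hτ : τ ⊆ Finset.Icc 2 n) (h : Consec n τ t₁ t₃) (h₁ : t₁ < t)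
    (h₃ : t < t₃) {u w : ℕ} (huw : Consec n (insert t τ) u w) :
    (u = t₁ ∧ w = t) ∨ (u = t ∧ w = t₃) ∨ (Consec n τ u w ∧ (w ≤ t₁ ∨ t₃ ≤ u)) := by
  have hmem := h.mem_Icc hτ h₁ h₃
  have hn : 1 ≤ n := by
    have := Finset.mem_Icc.1 hmem
    omega
  have hτ' : insert t τ ⊆ Finset.Icc 2 n := Finset.insert_subset hmem hτ
  have hw := huw.nextPoint_eq hτ'
  rcases eq_or_ne u t with rfl | hut
  · exact Or.inr (Or.inl ⟨rfl, hw.symm.trans ((h.insert_right h₁ h₃).nextPoint_eq hτ')⟩)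
  · have hu : u ∈ insert 1 τ := by
      have := huw.left
      simp only [Finset.mem_insert] at this ⊢
      tauto
    rcases eq_or_ne u t₁ with rfl | hut₁
    · exact Or.inl ⟨rfl, hw.symm.trans ((h.insert_left h₁ h₃).nextPoint_eq hτ')⟩
    · refine Or.inr (Or.inr ?_)
      have hc := consec_nextPoint hn hτ hu
      rw [← nextPoint_insert_of_ne hn hτ h h₁ h₃ hu hut₁, hw] at hc
      refine ⟨hc, ?_⟩
      rcases lt_or_gt_of_ne hut₁ with hlt | hgt
      · left
        rcases Finset.mem_insert.1 h.left with h' | h'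
        · have := hc.one_le hτ
          omega
        · exact hc.gap _ h' hlt
      · right
        rcases Finset.mem_insert.1 hu with h' | h'
        · have := h.one_le hτ
          omega
        · exact h.gap _ h' hgt

/-- The unit vector whose inner product with `x` is the CUSUM statistic `cusum x t₁ t t₃`. -/
def contrast (n t₁ t t₃ : ℕ) : EuclideanSpace ℝ (Fin n) :=
  WithLp.toLp 2 fun i : Fin n =>
    ((if t ≤ (i : ℕ) + 1 ∧ (i : ℕ) + 1 < t₃ then 1 else 0) / ((t₃ : ℝ) - t) -
      (if t₁ ≤ (i : ℕ) + 1 ∧ (i : ℕ) + 1 < t then 1 else 0) / ((t : ℝ) - t₁)) *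
      √(((t : ℝ) - t₁) * ((t₃ : ℝ) - t) / ((t₃ : ℝ) - t₁))

theorem inner_contrast (x : EuclideanSpace ℝ (Fin n)) :
    inner ℝ x (contrast n t₁ t t₃) = cusum (fun i => x i) t₁ t t₃ := by
  unfold contrast cusum segSum
  rw [PiLp.inner_apply, Finset.sum_filter, Finset.sum_filter, Finset.sum_div, Finset.sum_div,
    ← Finset.sum_sub_distrib, Finset.sum_mul]
  refine Finset.sum_congr rfl fun i _ => ?_
  simp only [RCLike.inner_apply, conj_trivial]
  split_ifs <;> ring

theorem contrast_apply_left {i : Fin n} (hi : t₁ ≤ (i : ℕ) + 1) (hi' : (i : ℕ) + 1 < t) :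
    contrast n t₁ t t₃ i =
      -(1 / ((t : ℝ) - t₁) * √(((t : ℝ) - t₁) * ((t₃ : ℝ) - t) / ((t₃ : ℝ) - t₁))) := by
  simp only [contrast]
  rw [if_neg (by omega), if_pos ⟨hi, hi'⟩]
  ring

theorem contrast_apply_right {i : Fin n} (hi : t ≤ (i : ℕ) + 1) (hi' : (i : ℕ) + 1 < t₃) :
    contrast n t₁ t t₃ i =
      1 / ((t₃ : ℝ) - t) * √(((t : ℝ) - t₁) * ((t₃ : ℝ) - t) / ((t₃ : ℝ) - t₁)) := by
  simp only [contrast]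
  rw [if_pos ⟨hi, hi'⟩, if_neg (by omega)]
  ring

theorem contrast_apply_outside (h₁ : t₁ < t) (h₃ : t < t₃) {i : Fin n}
    (hi : (i : ℕ) + 1 < t₁ ∨ t₃ ≤ (i : ℕ) + 1) : contrast n t₁ t t₃ i = 0 := by
  simp only [contrast]
  rw [if_neg (by omega), if_neg (by omega)]
  ring

theorem inner_contrast_self (h₀ : 1 ≤ t₁) (h₁ : t₁ < t) (h₃ : t < t₃) (h₄ : t₃ ≤ n + 1) :
    inner ℝ (contrast n t₁ t t₃) (contrast n t₁ t t₃) = 1 := by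
  have h12 : (0 : ℝ) < (t : ℝ) - t₁ := by simpa using h₁
  have h23 : (0 : ℝ) < (t₃ : ℝ) - t := by simpa using h₃
  have h13 : (0 : ℝ) < (t₃ : ℝ) - t₁ := by linarith
  have hs := Real.mul_self_sqrt
    (show 0 ≤ ((t : ℝ) - t₁) * ((t₃ : ℝ) - t) / ((t₃ : ℝ) - t₁) by positivity)
  rw [inner_contrast]
  unfold cusum
  rw [segSum_eq_of_const (fun i => contrast n t₁ t t₃ i) _ (by omega) h₃.le h₄
      (fun i hi hi' => contrast_apply_right hi hi'),
    segSum_eq_of_const (fun i => contrast n t₁ t t₃ i) _ h₀ h₁.le (by omega)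
      (fun i hi hi' => contrast_apply_left hi hi'),
    mul_div_cancel_left₀ _ h12.ne', mul_div_cancel_left₀ _ h23.ne']
  rw [show ∀ a b s : ℝ, (1 / a * s - -(1 / b * s)) * s = (1 / a + 1 / b) * (s * s) by
    intros; ring, hs]
  field_simp
  ring

/-- Splitting the segment `[t₁, t₃)` at `t` lowers the residual sum of squares by the square of the
CUSUM statistic. -/
theorem norm_sub_starProjection_insert (Y : EuclideanSpace ℝ (Fin n)) (hτ : τ ⊆ Finset.Icc 2 n)
    (h : Consec n τ t₁ t₃) (h₁ : t₁ < t) (h₃ : t < t₃) :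
    ‖Y - (piecewiseConst n (insert t τ)).starProjection Y‖ ^ 2 =
      ‖Y - (piecewiseConst n τ).starProjection Y‖ ^ 2 - cusum (fun i => Y i) t₁ t t₃ ^ 2 := by
  have hmem := h.mem_Icc hτ h₁ h₃
  have hn : 1 ≤ n := by
    have := Finset.mem_Icc.1 hmem
    omega
  have hτ' : insert t τ ⊆ Finset.Icc 2 n := Finset.insert_subset hmem hτ
  have ht₁ := h.one_le hτ
  have ht₃ := h.le_succ hτ
  have h12 : (0 : ℝ) < (t : ℝ) - t₁ := by simpa using h₁
  have h23 : (0 : ℝ) < (t₃ : ℝ) - t := by simpa using h₃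
  have h13 : (0 : ℝ) < (t₃ : ℝ) - t₁ := by linarith
  -- The larger space is the orthogonal sum of the smaller one and the line spanned by the unit
  -- vector `c`. Hence the new projection is `P + k • c`, and the squared residual drops by `k ^ 2`.
  set c := contrast n t₁ t t₃ with hc
  set k := cusum (fun i => Y i) t₁ t t₃ with hk
  set P := (piecewiseConst n τ).starProjection Y with hP
  have hPmem : P ∈ piecewiseConst n τ := Submodule.starProjection_apply_mem _ _
  have hcc : inner ℝ c c = 1 := inner_contrast_self ht₁ h₁ h₃ ht₃
  have horth : ∀ x ∈ piecewiseConst n τ, inner ℝ x c = 0 := by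
    intro x hx
    rw [mem_piecewiseConst_iff hn hτ] at hx
    rw [hc, inner_contrast]
    -- Index `t₁ - 1` is the observation at time `t₁`, the first one of the segment.
    exact cusum_eq_zero_of_const _ (x ⟨t₁ - 1, by omega⟩) ht₁ h₁ h₃ ht₃
      (fun i hi hi' => hx t₁ t₃ h i _ hi hi' (by simp; omega) (by simp; omega))
  have hle : ∀ x ∈ piecewiseConst n τ, x ∈ piecewiseConst n (insert t τ) := by
    intro x hx
    rw [mem_piecewiseConst_iff hn hτ] at hx
    rw [mem_piecewiseConst_iff hn hτ']
    intro u w huw i j hi hi' hj hj'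
    rcases Consec.of_insert hτ h h₁ h₃ huw with ⟨rfl, rfl⟩ | ⟨rfl, rfl⟩ | ⟨huw, -⟩
    · exact hx _ _ h i j hi (by omega) hj (by omega)
    · exact hx _ _ h i j (by omega) hi' (by omega) hj'
    · exact hx _ _ huw i j hi hi' hj hj'
  have hcmem : c ∈ piecewiseConst n (insert t τ) := by
    rw [mem_piecewiseConst_iff hn hτ']
    intro u w huw i j hi hi' hj hj'
    rcases Consec.of_insert hτ h h₁ h₃ huw with ⟨rfl, rfl⟩ | ⟨rfl, rfl⟩ | ⟨-, hd⟩
    · rw [hc, contrast_apply_left hi hi', contrast_apply_left hj hj']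
    · rw [hc, contrast_apply_right hi hi', contrast_apply_right hj hj']
    · rw [hc, contrast_apply_outside h₁ h₃ (by omega), contrast_apply_outside h₁ h₃ (by omega)]
  have hdecomp : ∀ x ∈ piecewiseConst n (insert t τ), ∃ r : ℝ, x - r • c ∈ piecewiseConst n τ := by
    intro x hx
    rw [mem_piecewiseConst_iff hn hτ'] at hx
    set s := √(((t : ℝ) - t₁) * ((t₃ : ℝ) - t) / ((t₃ : ℝ) - t₁)) with hs
    have hspos : 0 < s := by rw [hs]; positivity
    set A := x ⟨t₁ - 1, by omega⟩ with hA
    set B := x ⟨t - 1, by omega⟩ with hB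
    have hxA : ∀ i : Fin n, t₁ ≤ (i : ℕ) + 1 → (i : ℕ) + 1 < t → x i = A := fun i hi hi' =>
      hx _ _ (h.insert_left h₁ h₃) i _ hi hi' (by simp; omega) (by simp; omega)
    have hxB : ∀ i : Fin n, t ≤ (i : ℕ) + 1 → (i : ℕ) + 1 < t₃ → x i = B := fun i hi hi' =>
      hx _ _ (h.insert_right h₁ h₃) i _ hi hi' (by simp; omega) (by simp; omega)
    -- This multiple of `c` has a jump of height `B - A` at `t`; subtracting it makes the values on
    -- the two sides of `t` agree.
    refine ⟨(B - A) / (1 / ((t₃ : ℝ) - t) * s + 1 / ((t : ℝ) - t₁) * s), ?_⟩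
    set r := (B - A) / (1 / ((t₃ : ℝ) - t) * s + 1 / ((t : ℝ) - t₁) * s) with hr
    have hrAB : A + r * (1 / ((t : ℝ) - t₁) * s) = B - r * (1 / ((t₃ : ℝ) - t) * s) := by
      have : r * (1 / ((t₃ : ℝ) - t) * s + 1 / ((t : ℝ) - t₁) * s) = B - A :=
        div_mul_cancel₀ _ (by positivity)
      linarith
    have hval : ∀ i : Fin n, t₁ ≤ (i : ℕ) + 1 → (i : ℕ) + 1 < t₃ →
        (x - r • c) i = A + r * (1 / ((t : ℝ) - t₁) * s) := by
      intro i hi hi'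
      rw [PiLp.sub_apply, PiLp.smul_apply, smul_eq_mul]
      rcases lt_or_ge ((i : ℕ) + 1) t with hlt | hge
      · rw [hc, contrast_apply_left hi hlt, hxA i hi hlt]
        ring
      · rw [hc, contrast_apply_right hge hi', hxB i hge hi', hrAB]
    rw [mem_piecewiseConst_iff hn hτ]
    intro u w huw i j hi hi' hj hj'
    rcases eq_or_ne u t₁ with rfl | hut₁
    · have : w = t₃ := (huw.nextPoint_eq hτ).symm.trans (h.nextPoint_eq hτ)
      subst this
      rw [hval i hi hi', hval j hj hj']
    · have hd : w ≤ t₁ ∨ t₃ ≤ u := by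
        rcases lt_or_gt_of_ne hut₁ with hlt | hgt
        · left
          rcases Finset.mem_insert.1 h.left with h' | h'
          · have := huw.one_le hτ
            omega
          · exact huw.gap _ h' hlt
        · right
          rcases Finset.mem_insert.1 huw.left with h' | h'
          · omega
          · exact h.gap _ h' hgt
      simp only [PiLp.sub_apply, PiLp.smul_apply]
      rw [hc, contrast_apply_outside h₁ h₃ (by omega), contrast_apply_outside h₁ h₃ (by omega),
        hx u w (huw.insert_of_notMem (by omega)) i j hi hi' hj hj']
  have hYc : inner ℝ Y c = k := inner_contrast Y
  have hPc : inner ℝ P c = 0 := horth P hPmem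
  have hproj : (piecewiseConst n (insert t τ)).starProjection Y = P + k • c := by
    refine Submodule.eq_starProjection_of_mem_of_inner_eq_zero
      (Submodule.add_mem _ (hle P hPmem) (Submodule.smul_mem _ _ hcmem)) ?_
    intro x hx
    obtain ⟨r, hr⟩ := hdecomp x hx
    have e1 : inner ℝ (Y - P) (x - r • c) = 0 := Submodule.starProjection_inner_eq_zero Y _ hr
    have e2 : inner ℝ (x - r • c) c = 0 := horth _ hr
    have e3 : inner ℝ (Y - (P + k • c)) c = 0 := by
      rw [inner_sub_left, inner_add_left, inner_smul_left, hYc, hPc, hcc]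
      simp
    have e4 : inner ℝ (Y - (P + k • c)) (x - r • c) = 0 := by
      rw [← sub_sub, inner_sub_left, e1, inner_smul_left, real_inner_comm, e2]
      simp
    have : x = (x - r • c) + r • c := by simp
    rw [this, inner_add_right, e4, inner_smul_right, e3]
    simp
  rw [hproj, ← sub_sub, norm_sub_sq_real, inner_smul_right, inner_sub_left, hYc, hPc, norm_smul,
    mul_pow, ← real_inner_self_eq_norm_sq c, hcc, Real.norm_eq_abs, sq_abs]
  ring

end Insert

/-! ### Additivity of the criterion over segments -/

/-- The contribution of a segment `[u, w)` to the criterion, up to a constant. -/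
def segCost {n : ℕ} (L q : ℝ) (Y : Fin n → ℝ) (u w : ℕ) : ℝ :=
  L * (2 * Real.log ((n : ℝ) / ((w : ℝ) - u)) + q) - segSum Y u w ^ 2 / ((w : ℝ) - u)

/-- The square of the threshold, as a function of the lengths of the two segments. -/
def thresholdSq (n q x y : ℝ) : ℝ := 2 * Real.log (n * (x + y) / (x * y)) + q

/-- The penalty `q` is charged once per segment, so one cut costs exactly one more `q`, and the
three logarithms combine into that of the threshold. The quadratic part is the usual between-groups
decomposition of a sum of squares. With `L = 0` only that decomposition remains. -/
theorem segCost_add_segCost {n : ℕ} (L q : ℝ) (Y : Fin n → ℝ) {t₁ t t₃ : ℕ} (hn : 1 ≤ n)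
    (h₁ : t₁ < t) (h₃ : t < t₃) :
    segCost L q Y t₁ t + segCost L q Y t t₃ - segCost L q Y t₁ t₃ =
      L * thresholdSq n q ((t : ℝ) - t₁) ((t₃ : ℝ) - t) - cusum Y t₁ t t₃ ^ 2 := by
  have h12 : (0 : ℝ) < (t : ℝ) - t₁ := by simpa using h₁
  have h23 : (0 : ℝ) < (t₃ : ℝ) - t := by simpa using h₃
  have h13 : (0 : ℝ) < (t₃ : ℝ) - t₁ := by linarith
  have hn0 : (0 : ℝ) < n := by exact_mod_cast hn
  unfold segCost cusum thresholdSq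
  rw [mul_pow, Real.sq_sqrt (by positivity), ← segSum_add_segSum Y h₁.le h₃.le]
  obtain ⟨x, hx⟩ : ∃ x, x = (t : ℝ) - t₁ := ⟨_, rfl⟩
  obtain ⟨y, hy⟩ : ∃ y, y = (t₃ : ℝ) - t := ⟨_, rfl⟩
  rw [show (t₃ : ℝ) - t₁ = x + y by rw [hx, hy]; ring, ← hx, ← hy]
  rw [← hx] at h12
  rw [← hy] at h23
  rw [Real.log_div hn0.ne' h12.ne', Real.log_div hn0.ne' h23.ne',
    Real.log_div hn0.ne' (by positivity), Real.log_div (by positivity) (by positivity),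
    Real.log_mul hn0.ne' (by positivity), Real.log_mul h12.ne' h23.ne']
  field_simp
  ring

theorem crit_insert {n : ℕ} {τ : Finset ℕ} {t₁ t t₃ : ℕ} (L q : ℝ) (Y : Fin n → ℝ)
    (hτ : τ ⊆ Finset.Icc 2 n) (h : Consec n τ t₁ t₃) (h₁ : t₁ < t) (h₃ : t < t₃) :
    crit L q Y (insert t τ) =
      crit L q Y τ + (segCost L q Y t₁ t + segCost L q Y t t₃ - segCost L q Y t₁ t₃) := by
  have hn : 1 ≤ n := by
    have := Finset.mem_Icc.1 (h.mem_Icc hτ h₁ h₃)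
    omega
  have h12 : (0 : ℝ) < (t : ℝ) - t₁ := by simpa using h₁
  have h23 : (0 : ℝ) < (t₃ : ℝ) - t := by simpa using h₃
  have hn0 : (0 : ℝ) < n := by exact_mod_cast hn
  rw [segCost_add_segCost L q Y hn h₁ h₃]
  unfold crit
  rw [norm_sub_starProjection_insert _ hτ h h₁ h₃, pen_insert q hτ h h₁ h₃]
  unfold thresholdSq
  rw [show (t : ℝ) - t₁ + ((t₃ : ℝ) - t) = (t₃ : ℝ) - t₁ by ring,
    Real.log_div hn0.ne' h12.ne', Real.log_div hn0.ne' h23.ne',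
    Real.log_div hn0.ne' (by linarith), Real.log_div (mul_pos hn0 (by linarith)).ne' (by positivity),
    Real.log_mul hn0.ne' (by linarith), Real.log_mul h12.ne' h23.ne']
  ring

/-- The total contribution of the segments cut out of `[u, w)` by a list of points. -/
def chainCost {n : ℕ} (L q : ℝ) (Y : Fin n → ℝ) : ℕ → List ℕ → ℕ → ℝ
  | u, [], w => segCost L q Y u w
  | u, x :: l, w => segCost L q Y u x + chainCost L q Y x l w

theorem lt_of_isChain {l : List ℕ} : ∀ {u w : ℕ}, List.IsChain (· < ·) (u :: (l ++ [w])) →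
    u < w ∧ ∀ x ∈ l, u < x ∧ x < w := by
  induction l with
  | nil =>
    intro u w h
    simpa using h
  | cons x l ih =>
    intro u w h
    rw [List.cons_append, List.isChain_cons_cons] at h
    have := ih h.2
    refine ⟨by omega, fun y hy => ?_⟩
    rcases List.mem_cons.1 hy with rfl | hy
    · omega
    · have := this.2 y hy
      omega

/-- Inserting the points from left to right, each one splits the last segment ending at `t₃`; the
costs of these temporary segments telescope. -/
theorem crit_union_list {n : ℕ} (L q : ℝ) (Y : Fin n → ℝ) {t₃ : ℕ} (l : List ℕ) :
    ∀ {τ : Finset ℕ} {t₁ : ℕ}, τ ⊆ Finset.Icc 2 n → Consec n τ t₁ t₃ →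
      List.IsChain (· < ·) (t₁ :: (l ++ [t₃])) →
      l.toFinset ∪ τ ⊆ Finset.Icc 2 n ∧
      crit L q Y (l.toFinset ∪ τ) =
        crit L q Y τ + chainCost L q Y t₁ l t₃ - segCost L q Y t₁ t₃ := by
  induction l with
  | nil =>
    intro τ t₁ hτ h _
    simp [chainCost, hτ]
  | cons x l ih =>
    intro τ t₁ hτ h hl
    have hx := (lt_of_isChain hl).2 x (by simp)
    rw [List.cons_append, List.isChain_cons_cons] at hl
    have hτ' : insert x τ ⊆ Finset.Icc 2 n := Finset.insert_subset (h.mem_Icc hτ hx.1 hx.2) hτ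
    have hu : (x :: l).toFinset ∪ τ = l.toFinset ∪ insert x τ := by
      rw [List.toFinset_cons, Finset.insert_union, Finset.union_insert]
    obtain ⟨h1, h2⟩ := ih hτ' (h.insert_right hx.1 hx.2) hl.2
    rw [hu]
    refine ⟨h1, ?_⟩
    rw [h2, crit_insert L q Y hτ h hx.1 hx.2, chainCost]
    ring

/-- Optimality of a penalized least-squares estimate, between two of its points: no other list of
points is cheaper. -/
theorem IsPenalizedLSE.chainCost_le {n : ℕ} {L q : ℝ} {Y : Fin n → ℝ} {τ : Finset ℕ}
    (hmin : IsPenalizedLSE L q Y τ) {t₁ t₃ : ℕ} {l₀ l : List ℕ} (h₁ : t₁ ∈ insert 1 τ)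
    (h₃ : t₃ ∈ insert (n + 1) τ) (hl₀ : List.IsChain (· < ·) (t₁ :: (l₀ ++ [t₃])))
    (hl₀τ : ∀ x ∈ l₀, x ∈ τ) (hgap : ∀ x ∈ τ, t₁ < x → x < t₃ → x ∈ l₀)
    (hl : List.IsChain (· < ·) (t₁ :: (l ++ [t₃]))) :
    chainCost L q Y t₁ l₀ t₃ ≤ chainCost L q Y t₁ l t₃ := by
  obtain ⟨hτ, hmin⟩ := hmin
  have hlt := lt_of_isChain hl₀
  have hτ₀ : τ \ l₀.toFinset ⊆ Finset.Icc 2 n := Finset.sdiff_subset.trans hτ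
  -- Deleting `l₀` merges everything between `t₁` and `t₃` into one segment. The estimate and its
  -- competitor are both refinements of this common base, whose cost cancels.
  have hc : Consec n (τ \ l₀.toFinset) t₁ t₃ := by
    refine ⟨?_, ?_, hlt.1, ?_⟩
    · rw [Finset.mem_insert, Finset.mem_sdiff, List.mem_toFinset]
      rcases Finset.mem_insert.1 h₁ with h | h
      · exact Or.inl h
      · exact Or.inr ⟨h, fun h' => (hlt.2 _ h').1.false⟩
    · rw [Finset.mem_insert, Finset.mem_sdiff, List.mem_toFinset]
      rcases Finset.mem_insert.1 h₃ with h | h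
      · exact Or.inl h
      · exact Or.inr ⟨h, fun h' => (hlt.2 _ h').2.false⟩
    · intro x hx hx₁
      rw [Finset.mem_sdiff, List.mem_toFinset] at hx
      by_contra hx₃
      exact hx.2 (hgap x hx.1 hx₁ (not_le.1 hx₃))
  have hu : l₀.toFinset ∪ τ \ l₀.toFinset = τ :=
    Finset.union_sdiff_of_subset fun x hx => hl₀τ x (List.mem_toFinset.1 hx)
  have e₀ := (crit_union_list L q Y l₀ hτ₀ hc hl₀).2
  obtain ⟨hsub, e₁⟩ := crit_union_list L q Y l hτ₀ hc hl
  have := hmin _ hsub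
  rw [hu] at e₀
  linarith

/-! ### Thresholds as functions of the lengths -/

/-- The squared threshold of a segment of length `z`. -/
def scale (n q z : ℝ) : ℝ := 2 * Real.log (n / z) + q

section Thresholds

variable {n q x y z : ℝ}

theorem thresholdSq_comm : thresholdSq n q x y = thresholdSq n q y x := by
  unfold thresholdSq
  rw [add_comm x y, mul_comm x y]

/-- A free reference length `z` separates the dependence on scale from that on the ratios of
lengths; thresholds at comparable lengths then differ by constants only. -/
theorem thresholdSq_eq_scale_add (hn : 0 < n) (hx : 0 < x) (hy : 0 < y) (hz : 0 < z) :
    thresholdSq n q x y = scale n q z + 2 * Real.log (z / x + z / y) := by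
  unfold thresholdSq scale
  have : n * (x + y) / (x * y) = n / z * (z / x + z / y) := by
    field_simp
    ring
  rw [this, Real.log_mul (by positivity) (by positivity)]
  ring

theorem le_scale (hz : 0 < z) (hzn : z ≤ n) : q ≤ scale n q z := by
  unfold scale
  have := Real.log_nonneg ((one_le_div hz).2 hzn)
  linarith

theorem scale_le_thresholdSq (hn : 0 < n) (hx : 0 < x) (hz : 0 < z) :
    scale n q z ≤ thresholdSq n q x z := by
  rw [thresholdSq_eq_scale_add hn hx hz hz, div_self hz.ne']
  have : 0 ≤ Real.log (z / x + 1) := Real.log_nonneg (by have := div_pos hz hx; linarith)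
  linarith

theorem thresholdSq_anti {x' y' : ℝ} (hn : 0 < n) (hx : 0 < x) (hy : 0 < y) (hxx' : x ≤ x')
    (hyy' : y ≤ y') : thresholdSq n q x' y' ≤ thresholdSq n q x y := by
  have hx' : 0 < x' := by linarith
  have hy' : 0 < y' := by linarith
  rw [thresholdSq_eq_scale_add hn hx' hy' one_pos, thresholdSq_eq_scale_add hn hx hy one_pos]
  have : Real.log (1 / x' + 1 / y') ≤ Real.log (1 / x + 1 / y) :=
    Real.log_le_log (by positivity)
      (add_le_add (one_div_le_one_div_of_le hx hxx') (one_div_le_one_div_of_le hy hyy'))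
  linarith

/-- The crude bound of a logarithm by its argument is enough, since bounded errors are negligible
against `q`. -/
theorem thresholdSq_le_scale_add (hn : 0 < n) (hx : 0 < x) (hy : 0 < y) (hz : 0 < z) {r : ℝ}
    (hr : z / x + z / y ≤ r) : thresholdSq n q x y ≤ scale n q z + 2 * r := by
  rw [thresholdSq_eq_scale_add hn hx hy hz]
  have h0 : 0 < z / x + z / y := by positivity
  have := Real.log_le_sub_one_of_pos h0
  linarith

end Thresholds

/-! ### The gain from removing or moving one point -/

section Side

variable {n q L x y z ν e f : ℝ}

/-- Young's inequality with very unequal weights: the contaminating statistic `e` keeps a factor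
close to `1`, while the clean one `ν`, which is tiny, may be multiplied by a large constant. The
condition on `z` and `y` keeps the coefficient at most `2`. -/
theorem sq_cusum_le (hx : 0 < x) (hy : 0 < y) (hz : 0 < z) (hyz : z ≤ 2 * y)
    (hf : f = √(1 + z * x / (y * (x + y + z))) * ν + √(z * x / (y * (x + y + z))) * e) :
    f ^ 2 ≤ 1.01 * (z * x / (y * (x + y + z))) * e ^ 2 + 303 * ν ^ 2 := by
  set α := z * x / (y * (x + y + z)) with hα
  have hα0 : 0 ≤ α := by positivity
  have hα2 : α ≤ 2 := by
    rw [hα, div_le_iff₀ (by positivity)]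
    nlinarith [mul_pos hx hy, mul_pos hy hz, mul_pos hx hz]
  have h1 := Real.sq_sqrt (show 0 ≤ 1 + α by linarith)
  have h2 := Real.sq_sqrt hα0
  set A := √(1 + α) * ν with hA
  set B := √α * e with hB
  have hA2 : A ^ 2 = (1 + α) * ν ^ 2 := by rw [hA, mul_pow, h1]
  have hB2 : B ^ 2 = α * e ^ 2 := by rw [hB, mul_pow, h2]
  have : A ^ 2 ≤ 3 * ν ^ 2 := by
    rw [hA2]
    nlinarith [sq_nonneg ν]
  rw [hf]
  nlinarith [sq_nonneg (10 * A - B / 10)]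

/-- If `x` is small, then the contribution of `e` to `f` is small. -/
theorem mul_sq_le_of_lt
    (hn : 0 < n) (hq : 10 ^ 8 ≤ q) (hL : 0 < L) (hx : 0 < x) (hy : 0 < y) (hz : 0 < z)
    (hzn : z ≤ n) (he : e ^ 2 ≤ L * thresholdSq n q x y)
    {β : ℝ} (hxz : x ≤ z) (hyz : z ≤ 2 * y)
    (hβ : z * x / (y * (x + y + z)) ≤ β) :
    z * x / (y * (x + y + z)) * e ^ 2 ≤ (β + 0.01) * (L * scale n q z) := by
  set α := z * x / (y * (x + y + z)) with hα
  have hα0 : 0 ≤ α := by positivity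
  have hs := le_scale (q := q) hz hzn
  -- As `x` tends to `0` this bound blows up like `z / x`, but the coefficient `α` vanishes at the
  -- rate `x / z`, so that the product in `h2` stays bounded.
  have h1 : thresholdSq n q x y ≤ scale n q z + 2 * (3 * (z / x)) := by
    refine thresholdSq_le_scale_add hn hx hy hz ?_
    have : z / y ≤ 2 := by rwa [div_le_iff₀ hy]
    have : 1 ≤ z / x := by rwa [le_div_iff₀ hx, one_mul]
    linarith
  have h2 : α * (z / x) ≤ 4 / 3 := by
    rw [hα, show z * x / (y * (x + y + z)) * (z / x) = z ^ 2 / (y * (x + y + z)) by field_simp,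
      div_le_iff₀ (by positivity)]
    nlinarith [mul_pos hx hy, mul_pos hy hz]
  have h3 : e ^ 2 ≤ L * (scale n q z + 2 * (3 * (z / x))) :=
    he.trans (mul_le_mul_of_nonneg_left h1 hL.le)
  have h4 : α * e ^ 2 ≤ α * (L * scale n q z) + 6 * L * (α * (z / x)) := by
    calc α * e ^ 2 ≤ α * (L * (scale n q z + 2 * (3 * (z / x)))) :=
          mul_le_mul_of_nonneg_left h3 hα0
      _ = _ := by ring
  have hW : 10 ^ 8 * L ≤ L * scale n q z := by
    rw [mul_comm]
    exact mul_le_mul_of_nonneg_left (hq.trans hs) hL.le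
  have h5 : 6 * L * (α * (z / x)) ≤ 6 * L * (4 / 3) :=
    mul_le_mul_of_nonneg_left h2 (by linarith)
  have h6 : α * (L * scale n q z) ≤ β * (L * scale n q z) :=
    mul_le_mul_of_nonneg_right hβ (by linarith)
  linarith

theorem mul_thresholdSq_le
    (hn : 0 < n) (hL : 0 < L) (hy : 0 < y) (hz : 0 < z)
    (hxz : z ≤ x) :
    L * thresholdSq n q x y ≤ L * thresholdSq n q y z := by
  rw [thresholdSq_comm (x := y)]
  exact mul_le_mul_of_nonneg_left (thresholdSq_anti hn hz hy hxz le_rfl) hL.le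

/-- Removing the point, or moving it, strictly lowers the criterion. -/
theorem gain_pos
    (hn : 0 < n) (hq : 10 ^ 8 ≤ q) (hL : 0 < L) (hx : 0 < x) (hy : 0 < y) (hz : 0 < z)
    (hzn : z ≤ n) (hν : ν ^ 2 ≤ 1 / 10 ^ 5 * (L * scale n q z))
    (he : e ^ 2 ≤ L * thresholdSq n q x y)
    (hf : f = √(1 + z * x / (y * (x + y + z))) * ν + √(z * x / (y * (x + y + z))) * e)
    (hyz : z ≤ 2 * y) :
    0 < L * thresholdSq n q (x + y) z - f ^ 2 ∨
    0 < (L * thresholdSq n q y z - ν ^ 2) - (L * thresholdSq n q x y - e ^ 2) := by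
  have hf2 := sq_cusum_le hx hy hz hyz hf
  have hs := le_scale (q := q) hz hzn
  have hrem := mul_le_mul_of_nonneg_left
    (scale_le_thresholdSq (q := q) hn (add_pos hx hy) hz) hL.le
  set W := L * scale n q z with hW
  have hW0 : 0 < W := mul_pos hL (by linarith)
  -- A short contaminated part (`x ≤ z`) has coefficient at most `0.8`, the worst case being `x = z
  -- = 2 * y`; then removal always pays.
  rcases le_total x z with hxz | hxz
  · left
    have := mul_sq_le_of_lt hn hq hL hx hy hz hzn he (β := 0.8) hxz hyz (by
      rw [div_le_iff₀ (by positivity)]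
      nlinarith [mul_pos hx hy, mul_pos hy hz, mul_pos hx hz])
    nlinarith
  -- Here the threshold at `(x, y)` is at most that at `(y, z)`, so if moving does not pay then `e ^
  -- 2 ≤ ν ^ 2`: both statistics are tiny, hence so is `f`, and removal pays.
  · by_contra hcon
    push Not at hcon
    have h1 := mul_thresholdSq_le (q := q) hn hL hy hz hxz
    have h2 : z * x / (y * (x + y + z)) ≤ 2 := by
      rw [div_le_iff₀ (by positivity)]
      nlinarith [mul_pos hx hy, mul_pos hy hz, mul_pos hx hz]
    have h3 : z * x / (y * (x + y + z)) * e ^ 2 ≤ 2 * e ^ 2 :=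
      mul_le_mul_of_nonneg_right h2 (sq_nonneg e)
    nlinarith [hcon.1, hcon.2]

/-- Removing the point, or moving it, lowers the criterion substantially, except possibly if the
lengths `y` and `z` are comparable. -/
theorem gain_large
    (hn : 0 < n) (hq : 10 ^ 8 ≤ q) (hL : 0 < L) (hx : 0 < x) (hy : 0 < y) (hz : 0 < z)
    (hzn : z ≤ n) (hν : ν ^ 2 ≤ 1 / 10 ^ 5 * (L * scale n q z))
    (he : e ^ 2 ≤ L * thresholdSq n q x y)
    (hf : f = √(1 + z * x / (y * (x + y + z))) * ν + √(z * x / (y * (x + y + z))) * e)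
    (hyz : z ≤ y) :
    0.6 * (L * scale n q z) ≤ L * thresholdSq n q (x + y) z - f ^ 2 ∨
    0.6 * (L * scale n q z) ≤
      (L * thresholdSq n q y z - ν ^ 2) - (L * thresholdSq n q x y - e ^ 2) ∨
    (y ≤ 2 * z ∧
      L * scale n q z - e ^ 2 - 0.02 * (L * scale n q z) ≤
        L * thresholdSq n q (x + y) z - f ^ 2 ∧
      e ^ 2 - 0.02 * (L * scale n q z) ≤
        (L * thresholdSq n q y z - ν ^ 2) - (L * thresholdSq n q x y - e ^ 2)) := by
  have hyz2 : z ≤ 2 * y := by linarith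
  have hf2 := sq_cusum_le hx hy hz hyz2 hf
  have hs := le_scale (q := q) hz hzn
  have hrem := mul_le_mul_of_nonneg_left
    (scale_le_thresholdSq (q := q) hn (add_pos hx hy) hz) hL.le
  have hWL : 10 ^ 8 * L ≤ L * scale n q z := by
    rw [mul_comm]
    exact mul_le_mul_of_nonneg_left (hq.trans hs) hL.le
  have hs2 : z ≤ x → L * thresholdSq n q x y ≤ L * scale n q z + 4 * L := by
    intro hxz
    have : thresholdSq n q x y ≤ scale n q z + 2 * 2 := by
      refine thresholdSq_le_scale_add hn hx hy hz ?_
      have : z / x ≤ 1 := (div_le_one hx).2 hxz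
      have : z / y ≤ 1 := (div_le_one hy).2 hyz
      linarith
    calc L * thresholdSq n q x y ≤ L * (scale n q z + 2 * 2) :=
          mul_le_mul_of_nonneg_left this hL.le
      _ = _ := by ring
  set W := L * scale n q z with hW
  have hW0 : 0 < W := mul_pos hL (by linarith)
  -- For `x ≤ z ≤ y` the coefficient is at most `1 / 3`, attained at equal lengths, and removal
  -- alone gains enough.
  rcases le_total x z with hxz | hxz
  · left
    have := mul_sq_le_of_lt hn hq hL hx hy hz hzn he (β := 1 / 3) hxz hyz2 (by
      rw [div_le_div_iff₀ (by positivity) (by norm_num)]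
      nlinarith [mul_pos hx hy, mul_pos hy hz, mul_pos hx hz])
    linarith
  · have h1 := mul_thresholdSq_le (q := q) hn hL hy hz hxz
    rcases le_or_gt (z * x / (y * (x + y + z))) (1 / 2) with hα | hα
    -- Removal gains about `W - e ^ 2 / 2` and moving about `e ^ 2`, so one of them reaches `0.6 *
    -- W`.
    · have h3 : z * x / (y * (x + y + z)) * e ^ 2 ≤ 1 / 2 * e ^ 2 :=
        mul_le_mul_of_nonneg_right hα (sq_nonneg e)
      by_contra hcon
      push Not at hcon
      linarith [hcon.1, hcon.2.1]
    -- With a coefficient close to `1` the two gains are about `W - e ^ 2` and `e ^ 2`: only their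
    -- sum is guaranteed. A coefficient above `1 / 2` forces `y < 2 * z`.
    · right; right
      have h2 : z * x / (y * (x + y + z)) ≤ 1 := by
        rw [div_le_one (by positivity)]
        nlinarith [mul_pos hx hy, mul_pos hy hz, mul_pos hx hz]
      have h3 : z * x / (y * (x + y + z)) * e ^ 2 ≤ 1 * e ^ 2 :=
        mul_le_mul_of_nonneg_right h2 (sq_nonneg e)
      have h4 := hs2 hxz
      refine ⟨?_, by linarith, by linarith⟩
      rw [lt_div_iff₀ (by positivity)] at hα
      by_contra hy2
      push Not at hy2
      nlinarith [mul_pos hx hy, mul_pos hy hz, mul_pos hx hz]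

end Side

/-! ### Comparing CUSUM statistics of overlapping triads -/

theorem sqrt_mul_eq_of_sq {a b c : ℝ} (hb : 0 ≤ b) (h : a = b ^ 2 * c) : √a = b * √c := by
  rw [h, Real.sqrt_mul (sq_nonneg b), Real.sqrt_sq hb]

/-- The algebra behind `cusum_left` and `cusum_right`. -/
theorem cusum_algebra {x y z M₁ M₂ M₃ : ℝ} (hx : 0 < x) (hy : 0 < y) (hz : 0 < z) :
    (M₃ - (x * M₁ + y * M₂) / (x + y)) * √((x + y) * z / (x + y + z)) =
      √(1 + z * x / (y * (x + y + z))) * ((M₃ - M₂) * √(y * z / (y + z))) +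
      √(z * x / (y * (x + y + z))) * ((M₂ - M₁) * √(x * y / (x + y))) := by
  have e1 : √(1 + z * x / (y * (x + y + z))) * √(y * z / (y + z)) =
      √((x + y) * z / (x + y + z)) := by
    rw [← Real.sqrt_mul (by positivity)]
    congr 1
    field_simp
    ring
  have e2 : √(z * x / (y * (x + y + z))) * √(x * y / (x + y)) =
      x / (x + y) * √((x + y) * z / (x + y + z)) := by
    rw [← Real.sqrt_mul (by positivity)]
    refine sqrt_mul_eq_of_sq (by positivity) ?_
    field_simp
  calc _ = (M₃ - M₂) * √((x + y) * z / (x + y + z)) +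
        (M₂ - M₁) * (x / (x + y) * √((x + y) * z / (x + y + z))) := by
        field_simp
        ring
    _ = _ := by
        linear_combination -(M₃ - M₂) * e1 - (M₂ - M₁) * e2

/-- The mean over `[t₁, a)` is the weighted average of the means over `[t₁, v)` and `[v, a)`, so
extending the left segment of a triad from `v` back to `t₁` mixes in the statistic at `v`. This
isolates the uncontrolled part of the signal, to the left of `v`. -/
theorem cusum_left {n : ℕ} (Y : Fin n → ℝ) {t₁ v a m : ℕ} (h₁ : t₁ < v) (h₂ : v < a)
    (h₃ : a < m) :
    cusum Y t₁ a m =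
      √(1 + ((m : ℝ) - a) * ((v : ℝ) - t₁) /
        (((a : ℝ) - v) * ((v : ℝ) - t₁ + ((a : ℝ) - v) + ((m : ℝ) - a)))) * cusum Y v a m +
      √(((m : ℝ) - a) * ((v : ℝ) - t₁) /
        (((a : ℝ) - v) * ((v : ℝ) - t₁ + ((a : ℝ) - v) + ((m : ℝ) - a)))) * cusum Y t₁ v a := by
  have hx : (0 : ℝ) < (v : ℝ) - t₁ := by simpa using h₁
  have hy : (0 : ℝ) < (a : ℝ) - v := by simpa using h₂
  have hz : (0 : ℝ) < (m : ℝ) - a := by simpa using h₃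
  unfold cusum
  rw [← segSum_add_segSum Y h₁.le h₂.le]
  obtain ⟨x, hx'⟩ : ∃ x, x = (v : ℝ) - t₁ := ⟨_, rfl⟩
  obtain ⟨y, hy'⟩ : ∃ y, y = (a : ℝ) - v := ⟨_, rfl⟩
  obtain ⟨z, hz'⟩ : ∃ z, z = (m : ℝ) - a := ⟨_, rfl⟩
  rw [show (m : ℝ) - t₁ = x + y + z by rw [hx', hy', hz']; ring,
    show (a : ℝ) - t₁ = x + y by rw [hx', hy']; ring,
    show (m : ℝ) - v = y + z by rw [hy', hz']; ring, ← hx', ← hy', ← hz']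
  rw [← hx'] at hx
  rw [← hy'] at hy
  rw [← hz'] at hz
  rw [← cusum_algebra hx hy hz, mul_div_cancel₀ _ hx.ne', mul_div_cancel₀ _ hy.ne']

theorem cusum_right {n : ℕ} (Y : Fin n → ℝ) {m b w t₃ : ℕ} (h₁ : m < b) (h₂ : b < w)
    (h₃ : w < t₃) :
    cusum Y m b t₃ =
      √(1 + ((b : ℝ) - m) * ((t₃ : ℝ) - w) /
        (((w : ℝ) - b) * ((t₃ : ℝ) - w + ((w : ℝ) - b) + ((b : ℝ) - m)))) * cusum Y m b w +
      √(((b : ℝ) - m) * ((t₃ : ℝ) - w) /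
        (((w : ℝ) - b) * ((t₃ : ℝ) - w + ((w : ℝ) - b) + ((b : ℝ) - m)))) * cusum Y b w t₃ := by
  have hx : (0 : ℝ) < (t₃ : ℝ) - w := by simpa using h₃
  have hy : (0 : ℝ) < (w : ℝ) - b := by simpa using h₂
  have hz : (0 : ℝ) < (b : ℝ) - m := by simpa using h₁
  unfold cusum
  rw [← segSum_add_segSum Y h₂.le h₃.le]
  obtain ⟨x, hx'⟩ : ∃ x, x = (t₃ : ℝ) - w := ⟨_, rfl⟩
  obtain ⟨y, hy'⟩ : ∃ y, y = (w : ℝ) - b := ⟨_, rfl⟩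
  obtain ⟨z, hz'⟩ : ∃ z, z = (b : ℝ) - m := ⟨_, rfl⟩
  rw [show (t₃ : ℝ) - m = x + y + z by rw [hx', hy', hz']; ring,
    show (t₃ : ℝ) - b = x + y by rw [hx', hy']; ring,
    show (w : ℝ) - m = y + z by rw [hy', hz']; ring, ← hx', ← hy', ← hz']
  rw [← hx'] at hx
  rw [← hy'] at hy
  rw [← hz'] at hz
  -- Time is reversed here: `x` is the farthest length on the right. Reversal changes the sign of
  -- every CUSUM statistic, whence the final `-key`.
  have key := cusum_algebra (M₁ := segSum Y w t₃ / x) (M₂ := segSum Y b w / y)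
    (M₃ := segSum Y m b / z) hx hy hz
  rw [mul_div_cancel₀ _ hx.ne', mul_div_cancel₀ _ hy.ne'] at key
  rw [mul_comm z (x + y), mul_comm z y, mul_comm y x]
  linear_combination -key

/-! ### Consequences of optimality on the noise event -/

/-- The noise vector `ε` satisfies all the bounds that define the noise event. -/
def NoiseBound {n : ℕ} (ε : Fin n → ℝ) (q : ℝ) : Prop :=
  ∀ t₁ t₂ t₃ : ℕ, 1 ≤ t₁ → t₁ < t₂ → t₂ < t₃ → t₃ ≤ n + 1 →
    |cusum ε t₁ t₂ t₃| ≤ 2 * threshold n q t₁ t₂ t₃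

/-- `x` takes the value `r` on the segment `[a, b)`. -/
def ConstOn {n : ℕ} (x : Fin n → ℝ) (r : ℝ) (a b : ℕ) : Prop :=
  ∀ i : Fin n, a ≤ (i : ℕ) + 1 → (i : ℕ) + 1 < b → x i = r

theorem ConstOn.mono {n : ℕ} {x : Fin n → ℝ} {r : ℝ} {a b a' b' : ℕ} (h : ConstOn x r a b)
    (ha : a ≤ a') (hb : b' ≤ b) : ConstOn x r a' b' :=
  fun i hi hi' => h i (ha.trans hi) (hi'.trans_le hb)

theorem threshold_eq {n : ℕ} (q : ℝ) (t₁ t₂ t₃ : ℕ) :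
    threshold n q t₁ t₂ t₃ = √(thresholdSq n q ((t₂ : ℝ) - t₁) ((t₃ : ℝ) - t₂)) := by
  unfold threshold thresholdSq
  rw [mul_comm ((t₃ : ℝ) - t₂), show (t₂ : ℝ) - t₁ + ((t₃ : ℝ) - t₂) = (t₃ : ℝ) - t₁ by ring]

theorem le_thresholdSq {n : ℕ} (q : ℝ) {t₁ t₂ t₃ : ℕ} (h₀ : 1 ≤ t₁) (h₁ : t₁ < t₂)
    (h₂ : t₂ < t₃) (h₃ : t₃ ≤ n + 1) :
    q ≤ thresholdSq n q ((t₂ : ℝ) - t₁) ((t₃ : ℝ) - t₂) := by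
  have hx : (0 : ℝ) < (t₂ : ℝ) - t₁ := by simpa using h₁
  have hy : (0 : ℝ) < (t₃ : ℝ) - t₂ := by simpa using h₂
  have hn : (0 : ℝ) < n := by
    have : 0 < n := by omega
    exact_mod_cast this
  refine (le_scale hy ?_).trans (scale_le_thresholdSq hn hx hy)
  have : t₃ ≤ n + t₂ := by omega
  have : (t₃ : ℝ) ≤ n + t₂ := by exact_mod_cast this
  linarith

/-- The square of the CUSUM statistic of a vector with one jump, at the jump. -/
theorem sq_cusum_of_jump {n : ℕ} {θ : Fin n → ℝ} {r₁ r₂ : ℝ} {a s b : ℕ} (ha : 1 ≤ a)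
    (has : a < s) (hsb : s < b) (hb : b ≤ n + 1) (h₁ : ConstOn θ r₁ a s) (h₂ : ConstOn θ r₂ s b) :
    cusum θ a s b ^ 2 =
      (r₂ - r₁) ^ 2 * (((s : ℝ) - a) * ((b : ℝ) - s) / ((s : ℝ) - a + ((b : ℝ) - s))) := by
  have hx : (0 : ℝ) < (s : ℝ) - a := by simpa using has
  have hy : (0 : ℝ) < (b : ℝ) - s := by simpa using hsb
  have hxy : (b : ℝ) - a = (s : ℝ) - a + ((b : ℝ) - s) := by ring
  unfold cusum
  rw [segSum_eq_of_const θ r₁ ha has.le (by omega) h₁,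
    segSum_eq_of_const θ r₂ (by omega) hsb.le hb h₂, mul_pow, hxy, Real.sq_sqrt (by positivity),
    mul_div_cancel_left₀ _ hx.ne', mul_div_cancel_left₀ _ hy.ne']

/-- The CUSUM statistic of a vector with one jump, at a point on the right of the jump. -/
theorem sq_cusum_le_of_jump_left {n : ℕ} {θ : Fin n → ℝ} {r₁ r₂ : ℝ} {a s b u : ℕ} (ha : 1 ≤ a)
    (has : a < s) (hsb : s < b) (hbu : b < u) (hu : u ≤ n + 1) (h₁ : ConstOn θ r₁ a s)
    (h₂ : ConstOn θ r₂ s u) :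
    cusum θ a b u ^ 2 ≤ ((s : ℝ) - a) / ((b : ℝ) - s) * cusum θ a s b ^ 2 := by
  have hx : (0 : ℝ) < (s : ℝ) - a := by simpa using has
  have hy : (0 : ℝ) < (b : ℝ) - s := by simpa using hsb
  have hz : (0 : ℝ) < (u : ℝ) - b := by simpa using hbu
  rw [sq_cusum_of_jump ha has hsb (by omega) h₁ (h₂.mono le_rfl hbu.le)]
  unfold cusum
  rw [← segSum_add_segSum θ has.le hsb.le, segSum_eq_of_const θ r₁ ha has.le (by omega) h₁,
    segSum_eq_of_const θ r₂ (by omega) hsb.le (by omega) (h₂.mono le_rfl hbu.le),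
    segSum_eq_of_const θ r₂ (by omega) hbu.le hu (h₂.mono hsb.le le_rfl)]
  obtain ⟨x, hx'⟩ : ∃ x, x = (s : ℝ) - a := ⟨_, rfl⟩
  obtain ⟨y, hy'⟩ : ∃ y, y = (b : ℝ) - s := ⟨_, rfl⟩
  obtain ⟨z, hz'⟩ : ∃ z, z = (u : ℝ) - b := ⟨_, rfl⟩
  rw [show (u : ℝ) - a = x + y + z by rw [hx', hy', hz']; ring,
    show (b : ℝ) - a = x + y by rw [hx', hy']; ring, ← hx', ← hy', ← hz']
  rw [← hx'] at hx
  rw [← hy'] at hy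
  rw [← hz'] at hz
  rw [mul_pow, Real.sq_sqrt (by positivity), mul_div_cancel_left₀ _ hz.ne',
    show r₂ - (x * r₁ + y * r₂) / (x + y) = (r₂ - r₁) * (x / (x + y)) by field_simp; ring,
    mul_pow, mul_assoc, mul_left_comm (x / y)]
  refine mul_le_mul_of_nonneg_left ?_ (sq_nonneg _)
  have : (x / (x + y)) ^ 2 * ((x + y) * z / (x + y + z)) =
      x / y * (x * y / (x + y)) * (z / (x + y + z)) := by field_simp
  rw [this]
  exact mul_le_of_le_one_right (by positivity) ((div_le_one (by positivity)).2 (by linarith))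

/-- The CUSUM statistic of a vector with one jump, at a point on the left of the jump. -/
theorem sq_cusum_le_of_jump_right {n : ℕ} {θ : Fin n → ℝ} {r₁ r₂ : ℝ} {u a s b : ℕ} (hu : 1 ≤ u)
    (hua : u < a) (has : a < s) (hsb : s < b) (hb : b ≤ n + 1) (h₁ : ConstOn θ r₁ u s)
    (h₂ : ConstOn θ r₂ s b) :
    cusum θ u a b ^ 2 ≤ ((b : ℝ) - s) / ((s : ℝ) - a) * cusum θ a s b ^ 2 := by
  have hx : (0 : ℝ) < (s : ℝ) - a := by simpa using has
  have hy : (0 : ℝ) < (b : ℝ) - s := by simpa using hsb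
  have hz : (0 : ℝ) < (a : ℝ) - u := by simpa using hua
  rw [sq_cusum_of_jump (by omega) has hsb hb (h₁.mono hua.le le_rfl) h₂]
  unfold cusum
  rw [← segSum_add_segSum θ has.le hsb.le,
    segSum_eq_of_const θ r₁ (by omega) has.le (by omega) (h₁.mono hua.le le_rfl),
    segSum_eq_of_const θ r₂ (by omega) hsb.le hb h₂,
    segSum_eq_of_const θ r₁ hu hua.le (by omega) (h₁.mono le_rfl has.le)]
  obtain ⟨x, hx'⟩ : ∃ x, x = (s : ℝ) - a := ⟨_, rfl⟩
  obtain ⟨y, hy'⟩ : ∃ y, y = (b : ℝ) - s := ⟨_, rfl⟩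
  obtain ⟨z, hz'⟩ : ∃ z, z = (a : ℝ) - u := ⟨_, rfl⟩
  rw [show (b : ℝ) - u = x + y + z by rw [hx', hy', hz']; ring,
    show (b : ℝ) - a = x + y by rw [hx', hy']; ring, ← hx', ← hy', ← hz']
  rw [← hx'] at hx
  rw [← hy'] at hy
  rw [← hz'] at hz
  rw [mul_pow, Real.sq_sqrt (by positivity), mul_div_cancel_left₀ _ hz.ne',
    show (x * r₁ + y * r₂) / (x + y) - r₁ = (r₂ - r₁) * (y / (x + y)) by field_simp; ring,
    mul_pow, mul_assoc, mul_left_comm (y / x)]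
  refine mul_le_mul_of_nonneg_left ?_ (sq_nonneg _)
  have : (y / (x + y)) ^ 2 * (z * (x + y) / (x + y + z)) =
      y / x * (x * y / (x + y)) * (z / (x + y + z)) := by field_simp
  rw [this]
  exact mul_le_of_le_one_right (by positivity) ((div_le_one (by positivity)).2 (by linarith))

section Optimality

variable {n : ℕ} {L q : ℝ} {θ ε : Fin n → ℝ} {τ : Finset ℕ}

theorem NoiseBound.sq_cusum_le (hε : NoiseBound ε q) (hq : 0 ≤ q) {t₁ t₂ t₃ : ℕ} (h₀ : 1 ≤ t₁)
    (h₁ : t₁ < t₂) (h₂ : t₂ < t₃) (h₃ : t₃ ≤ n + 1) :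
    cusum ε t₁ t₂ t₃ ^ 2 ≤ 4 * thresholdSq n q ((t₂ : ℝ) - t₁) ((t₃ : ℝ) - t₂) := by
  have h := hε t₁ t₂ t₃ h₀ h₁ h₂ h₃
  have hψ := le_thresholdSq q h₀ h₁ h₂ h₃
  rw [threshold_eq] at h
  have hs := Real.sq_sqrt (hq.trans hψ)
  rw [← sq_abs]
  nlinarith [abs_nonneg (cusum ε t₁ t₂ t₃), Real.sqrt_nonneg
    (thresholdSq n q ((t₂ : ℝ) - t₁) ((t₃ : ℝ) - t₂))]

theorem NoiseBound.sq_cusum_le_of_const (hε : NoiseBound ε q) (hq : 0 ≤ q) {r : ℝ}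
    {t₁ t₂ t₃ : ℕ} (h₀ : 1 ≤ t₁) (h₁ : t₁ < t₂) (h₂ : t₂ < t₃) (h₃ : t₃ ≤ n + 1)
    (hθ : ConstOn θ r t₁ t₃) :
    cusum (fun i => θ i + ε i) t₁ t₂ t₃ ^ 2 ≤
      4 * thresholdSq n q ((t₂ : ℝ) - t₁) ((t₃ : ℝ) - t₂) := by
  rw [cusum_add, cusum_eq_zero_of_const θ r h₀ h₁ h₂ h₃ hθ, zero_add]
  exact hε.sq_cusum_le hq h₀ h₁ h₂ h₃

/-- Inserting a point does not lower the criterion of an estimate. -/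
theorem IsPenalizedLSE.sq_cusum_le {Y : Fin n → ℝ} (hmin : IsPenalizedLSE L q Y τ)
    {t₁ t t₃ : ℕ} (hc : Consec n τ t₁ t₃) (h₁ : t₁ < t) (h₃ : t < t₃) :
    cusum Y t₁ t t₃ ^ 2 ≤ L * thresholdSq n q ((t : ℝ) - t₁) ((t₃ : ℝ) - t) := by
  have hn : 1 ≤ n := by
    have := Finset.mem_Icc.1 (hc.mem_Icc hmin.1 h₁ h₃)
    omega
  have h := hmin.chainCost_le (l₀ := []) (l := [t]) hc.left hc.right (by simpa using hc.lt)
    (by simp) (fun x hx hx₁ hx₃ => absurd (hc.gap x hx hx₁) (by omega)) (by simp; omega)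
  have := segCost_add_segCost L q Y hn h₁ h₃
  simp only [chainCost] at h
  linarith

/-- Removing a point does not lower the criterion of an estimate. -/
theorem IsPenalizedLSE.le_sq_cusum {Y : Fin n → ℝ} (hmin : IsPenalizedLSE L q Y τ)
    {t₁ a b : ℕ} (h₁ : Consec n τ t₁ a) (h₂ : Consec n τ a b) (ha : a ∈ τ) :
    L * thresholdSq n q ((a : ℝ) - t₁) ((b : ℝ) - a) ≤ cusum Y t₁ a b ^ 2 := by
  have hn : 1 ≤ n := by
    have := Finset.mem_Icc.1 (hmin.1 ha)
    omega
  have hab := h₂.lt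
  have hta := h₁.lt
  have h := hmin.chainCost_le (l₀ := [a]) (l := []) h₁.left h₂.right (by simp; omega)
    (by simpa using ha) (fun x hx hx₁ hx₃ => by
      have h1 := h₁.gap x hx hx₁
      rcases h1.eq_or_lt with h | h
      · simp [h]
      · have := h₂.gap x hx h
        omega) (by simp; omega)
  have := segCost_add_segCost L q Y hn h₁.lt h₂.lt
  simp only [chainCost] at h
  linarith

/-- Moving a point does not lower the criterion of an estimate. -/
theorem IsPenalizedLSE.segCost_le {Y : Fin n → ℝ} (hmin : IsPenalizedLSE L q Y τ)
    {t₁ a b v : ℕ} (h₁ : Consec n τ t₁ a) (h₂ : Consec n τ a b) (ha : a ∈ τ) (hv : t₁ < v)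
    (hv' : v < b) :
    segCost L q Y t₁ a + segCost L q Y a b ≤ segCost L q Y t₁ v + segCost L q Y v b := by
  have hab := h₂.lt
  have hta := h₁.lt
  have h := hmin.chainCost_le (l₀ := [a]) (l := [v]) h₁.left h₂.right (by simp; omega)
    (by simpa using ha) (fun x hx hx₁ hx₃ => by
      have h1 := h₁.gap x hx hx₁
      rcases h1.eq_or_lt with h | h
      · simp [h]
      · have := h₂.gap x hx h
        omega) (by simp; omega)
  simpa only [chainCost] using h

/-- A point of an estimate cannot be followed too closely by another one, if the signal is nearly
constant from a time `v` well before it on. -/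
theorem IsPenalizedLSE.false_of_left {Y : Fin n → ℝ} (hmin : IsPenalizedLSE L q Y τ)
    (hq : 10 ^ 8 ≤ q) (hL : 0 < L) {t₁ v a b : ℕ} (h₁ : Consec n τ t₁ a) (h₂ : Consec n τ a b)
    (ha : a ∈ τ) (hv : t₁ < v) (hva : v < a) (hy : b + 2 * v ≤ 3 * a)
    (hν : cusum Y v a b ^ 2 ≤ 1 / 10 ^ 5 * (L * scale n q ((b : ℝ) - a))) : False := by
  have hn : 1 ≤ n := by
    have := Finset.mem_Icc.1 (hmin.1 ha)
    omega
  have hab := h₂.lt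
  have hb := h₂.le_succ hmin.1
  have ha2 := Finset.mem_Icc.1 (hmin.1 ha)
  have hx0 : (0 : ℝ) < (v : ℝ) - t₁ := by simpa using hv
  have hy0 : (0 : ℝ) < (a : ℝ) - v := by simpa using hva
  have hz0 : (0 : ℝ) < (b : ℝ) - a := by simpa using hab
  have hzn : (b : ℝ) - a ≤ n := by
    have : b ≤ n + a := by omega
    have : (b : ℝ) ≤ n + a := by exact_mod_cast this
    linarith
  have hyz : (b : ℝ) - a ≤ 2 * ((a : ℝ) - v) := by
    have : (b : ℝ) + 2 * v ≤ 3 * a := by exact_mod_cast hy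
    linarith
  have he := hmin.sq_cusum_le h₁ hv hva
  have key := gain_pos (n := n) (q := q) (by exact_mod_cast hn) hq hL hx0 hy0 hz0 hzn hν he
    (cusum_left Y hv hva hab) hyz
  have r1 := hmin.le_sq_cusum h₁ h₂ ha
  have r2 := hmin.segCost_le h₁ h₂ ha hv (hva.trans hab)
  -- Going from `a` to `v` amounts to inserting `v` and then deleting `a` from `[v, b)`; `d1` and
  -- `d2` price these two moves.
  have d1 := segCost_add_segCost L q Y hn hva hab
  have d2 := segCost_add_segCost L q Y hn hv hva
  rw [show (v : ℝ) - t₁ + ((a : ℝ) - v) = (a : ℝ) - t₁ by ring] at key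
  rcases key with key | key <;> linarith

/-- The mirror image of `IsPenalizedLSE.false_of_left`. -/
theorem IsPenalizedLSE.false_of_right {Y : Fin n → ℝ} (hmin : IsPenalizedLSE L q Y τ)
    (hq : 10 ^ 8 ≤ q) (hL : 0 < L) {a b w t₃ : ℕ} (h₁ : Consec n τ a b) (h₂ : Consec n τ b t₃)
    (hb : b ∈ τ) (hbw : b < w) (hw : w < t₃) (hy : 3 * b ≤ a + 2 * w)
    (hν : cusum Y a b w ^ 2 ≤ 1 / 10 ^ 5 * (L * scale n q ((b : ℝ) - a))) : False := by
  have hn : 1 ≤ n := by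
    have := Finset.mem_Icc.1 (hmin.1 hb)
    omega
  have hab := h₁.lt
  have ha1 := h₁.one_le hmin.1
  have hb2 := Finset.mem_Icc.1 (hmin.1 hb)
  have hx0 : (0 : ℝ) < (t₃ : ℝ) - w := by simpa using hw
  have hy0 : (0 : ℝ) < (w : ℝ) - b := by simpa using hbw
  have hz0 : (0 : ℝ) < (b : ℝ) - a := by simpa using hab
  have hzn : (b : ℝ) - a ≤ n := by
    have : b ≤ n + a := by omega
    have : (b : ℝ) ≤ n + a := by exact_mod_cast this
    linarith
  have hyz : (b : ℝ) - a ≤ 2 * ((w : ℝ) - b) := by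
    have : 3 * (b : ℝ) ≤ a + 2 * w := by exact_mod_cast hy
    linarith
  have he := hmin.sq_cusum_le h₂ hbw hw
  rw [thresholdSq_comm] at he
  have key := gain_pos (n := n) (q := q) (by exact_mod_cast hn) hq hL hx0 hy0 hz0 hzn hν he
    (cusum_right Y hab hbw hw) hyz
  have r1 := hmin.le_sq_cusum h₁ h₂ hb
  have r2 := hmin.segCost_le h₁ h₂ hb (hab.trans hbw) hw
  have d1 := segCost_add_segCost L q Y hn hab hbw
  have d2 := segCost_add_segCost L q Y hn hbw hw
  rw [show (t₃ : ℝ) - w + ((w : ℝ) - b) = (t₃ : ℝ) - b by ring,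
    thresholdSq_comm (x := (t₃ : ℝ) - b), thresholdSq_comm (x := (w : ℝ) - b),
    thresholdSq_comm (x := (t₃ : ℝ) - w)] at key
  rcases key with key | key <;> linarith

theorem scale_bounds (hq : 10 ^ 8 ≤ q) (hL : 0 < L) {a b : ℕ} (ha : 1 ≤ a) (hab : a < b)
    (hb : b ≤ n + 1) : q ≤ scale n q ((b : ℝ) - a) ∧ 10 ^ 8 * L ≤ L * scale n q ((b : ℝ) - a) := by
  have hz0 : (0 : ℝ) < (b : ℝ) - a := by simpa using hab
  have hzn : (b : ℝ) - a ≤ n := by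
    have : b ≤ n + a := by omega
    have : (b : ℝ) ≤ n + a := by exact_mod_cast this
    linarith
  have := le_scale (q := q) hz0 hzn
  exact ⟨this, by nlinarith⟩

/-- Two consecutive points of an estimate cannot be close to each other if the signal is constant
between them and on a longer segment before them. -/
theorem false_of_const_left (hmin : IsPenalizedLSE L q (fun i => θ i + ε i) τ)
    (hε : NoiseBound ε q) (hq : 10 ^ 8 ≤ q) (hL : 10 ^ 8 ≤ L) {t₁ v a b : ℕ} {r : ℝ}
    (h₁ : Consec n τ t₁ a) (h₂ : Consec n τ a b) (ha : a ∈ τ) (hva : v < a)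
    (hθ : ConstOn θ r v b) (hv : t₁ < v → b + v ≤ 2 * a) : False := by
  have ht₁ := h₁.one_le hmin.1
  have hta := h₁.lt
  have hab := h₂.lt
  have hb := h₂.le_succ hmin.1
  have hn : (0 : ℝ) < n := by
    have := Finset.mem_Icc.1 (hmin.1 ha)
    exact_mod_cast (by omega : 0 < n)
  rcases lt_or_ge t₁ v with hlt | hge
  · have hν := hε.sq_cusum_le_of_const (by linarith) (by omega) hva hab hb hθ
    refine hmin.false_of_left hq (by linarith) h₁ h₂ ha hlt hva (by have := hv hlt; omega)
      (hν.trans ?_)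
    have hy0 : (0 : ℝ) < (a : ℝ) - v := by simpa using hva
    have hz0 : (0 : ℝ) < (b : ℝ) - a := by simpa using hab
    have hs := scale_bounds (n := n) (L := L) hq (by linarith) (by omega) hab hb
    have : thresholdSq n q ((a : ℝ) - v) ((b : ℝ) - a) ≤ scale n q ((b : ℝ) - a) + 2 * 2 := by
      refine thresholdSq_le_scale_add hn hy0 hz0 hz0 ?_
      have h := hv hlt
      have h : (b : ℝ) + v ≤ 2 * a := by exact_mod_cast h
      have : ((b : ℝ) - a) / ((a : ℝ) - v) ≤ 1 := (div_le_one hy0).2 (by linarith)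
      rw [div_self hz0.ne']
      linarith
    nlinarith [hs.1]
  -- If `t₁` is not before `v`, the statistic at `a` is pure noise: at most four squared thresholds,
  -- whereas keeping `a` requires `L` of them.
  · have hν := hε.sq_cusum_le_of_const (by linarith) ht₁ hta hab hb (hθ.mono hge le_rfl)
    have hr := hmin.le_sq_cusum h₁ h₂ ha
    have hψ := le_thresholdSq q ht₁ hta hab hb
    nlinarith

/-- The mirror image of `false_of_const_left`. -/
theorem false_of_const_right (hmin : IsPenalizedLSE L q (fun i => θ i + ε i) τ)
    (hε : NoiseBound ε q) (hq : 10 ^ 8 ≤ q) (hL : 10 ^ 8 ≤ L) {a b w t₃ : ℕ} {r : ℝ}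
    (h₁ : Consec n τ a b) (h₂ : Consec n τ b t₃) (hb : b ∈ τ) (hbw : b < w)
    (hθ : ConstOn θ r a w) (hw : w < t₃ → 2 * b ≤ a + w) : False := by
  have ha := h₁.one_le hmin.1
  have hab := h₁.lt
  have hbt := h₂.lt
  have ht₃ := h₂.le_succ hmin.1
  have hn : (0 : ℝ) < n := by
    have := Finset.mem_Icc.1 (hmin.1 hb)
    exact_mod_cast (by omega : 0 < n)
  rcases lt_or_ge w t₃ with hlt | hge
  · have hν := hε.sq_cusum_le_of_const (by linarith) ha hab hbw (by omega) hθ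
    refine hmin.false_of_right hq (by linarith) h₁ h₂ hb hbw hlt (by have := hw hlt; omega)
      (hν.trans ?_)
    have hy0 : (0 : ℝ) < (w : ℝ) - b := by simpa using hbw
    have hz0 : (0 : ℝ) < (b : ℝ) - a := by simpa using hab
    have hs := scale_bounds (n := n) (L := L) hq (by linarith) ha hab (by omega)
    have : thresholdSq n q ((b : ℝ) - a) ((w : ℝ) - b) ≤ scale n q ((b : ℝ) - a) + 2 * 2 := by
      refine thresholdSq_le_scale_add hn hz0 hy0 hz0 ?_
      have h := hw hlt
      have h : 2 * (b : ℝ) ≤ a + w := by exact_mod_cast h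
      have : ((b : ℝ) - a) / ((w : ℝ) - b) ≤ 1 := (div_le_one hy0).2 (by linarith)
      rw [div_self hz0.ne']
      linarith
    nlinarith [hs.1]
  · have hν := hε.sq_cusum_le_of_const (by linarith) ha hab hbt ht₃ (hθ.mono le_rfl hge)
    have hr := hmin.le_sq_cusum h₁ h₂ hb
    have hψ := le_thresholdSq q ha hab hbt ht₃
    nlinarith

/-- Used with `y` a noise statistic, for which `y ^ 2` is at most four squared thresholds: hence the
`44` in the two comparisons of signal and observations. -/
theorem sq_add_le (x y : ℝ) : (x + y) ^ 2 ≤ 1.1 * x ^ 2 + 11 * y ^ 2 := by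
  nlinarith [sq_nonneg (x - 10 * y)]

theorem sq_cusum_signal_le (hε : NoiseBound ε q) (hq : 0 ≤ q) {t₁ t₂ t₃ : ℕ} (h₀ : 1 ≤ t₁)
    (h₁ : t₁ < t₂) (h₂ : t₂ < t₃) (h₃ : t₃ ≤ n + 1) :
    cusum θ t₁ t₂ t₃ ^ 2 ≤ 1.1 * cusum (fun i => θ i + ε i) t₁ t₂ t₃ ^ 2 +
      44 * thresholdSq n q ((t₂ : ℝ) - t₁) ((t₃ : ℝ) - t₂) := by
  have h := hε.sq_cusum_le hq h₀ h₁ h₂ h₃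
  have h' := sq_add_le (cusum (fun i => θ i + ε i) t₁ t₂ t₃) (-cusum ε t₁ t₂ t₃)
  rw [cusum_add, add_neg_cancel_right] at h'
  rw [cusum_add]
  linarith [neg_sq (cusum ε t₁ t₂ t₃)]

theorem sq_cusum_observation_le (hε : NoiseBound ε q) (hq : 0 ≤ q) {t₁ t₂ t₃ : ℕ} (h₀ : 1 ≤ t₁)
    (h₁ : t₁ < t₂) (h₂ : t₂ < t₃) (h₃ : t₃ ≤ n + 1) :
    cusum (fun i => θ i + ε i) t₁ t₂ t₃ ^ 2 ≤ 1.1 * cusum θ t₁ t₂ t₃ ^ 2 +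
      44 * thresholdSq n q ((t₂ : ℝ) - t₁) ((t₃ : ℝ) - t₂) := by
  have h := hε.sq_cusum_le hq h₀ h₁ h₂ h₃
  have h' := sq_add_le (cusum θ t₁ t₂ t₃) (cusum ε t₁ t₂ t₃)
  rw [cusum_add]
  linarith

/-- The bound on the bias that a point close to the jump causes on the other side. -/
theorem bias_le (hn : 0 < n) (hq : 10 ^ 9 ≤ q) (hL : 10 ^ 8 ≤ L) {x y c : ℝ} (hx : 0 < x)
    (hy : 0 < y) (hxy : 10 ^ 6 * x ≤ y) (hyn : x + y ≤ n)
    (hc : c ≤ 1.1 * (L * thresholdSq n q x y) + 44 * thresholdSq n q x y) :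
    x / y * c ≤ 3 / 10 ^ 6 * (L * scale n q (x + y)) := by
  have hn0 : (0 : ℝ) < n := by exact_mod_cast hn
  have hs := le_scale (q := q) (add_pos hx hy) hyn
  have h1 : x / y ≤ 1 / 10 ^ 6 := by
    rw [div_le_iff₀ hy]
    linarith
  have hxy0 : 0 < x / y := div_pos hx hy
  have h2 := thresholdSq_le_scale_add (q := q) hn0 hx hy (add_pos hx hy) le_rfl
  -- The threshold at the short length `x` exceeds the scale of `x + y` by an amount that is
  -- unbounded as `x` tends to `0`; the prefactor `x / y` compensates for it.
  have h3 : x / y * ((x + y) / x + (x + y) / y) ≤ 4 := by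
    have : x / y * ((x + y) / x + (x + y) / y) = (1 + x / y) ^ 2 := by
      field_simp
      ring
    rw [this]
    nlinarith
  have hψ0 : 0 ≤ thresholdSq n q x y := by
    have := scale_le_thresholdSq (q := q) hn0 hx hy
    have := le_scale (q := q) hy (by linarith : y ≤ (n : ℝ))
    linarith
  have hc2 : c ≤ 2 * L * thresholdSq n q x y := by nlinarith
  have h4 : x / y * thresholdSq n q x y ≤ 1 / 10 ^ 6 * scale n q (x + y) + 8 := by
    calc x / y * thresholdSq n q x y ≤
          x / y * (scale n q (x + y) + 2 * ((x + y) / x + (x + y) / y)) :=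
          mul_le_mul_of_nonneg_left h2 hxy0.le
      _ = x / y * scale n q (x + y) + 2 * (x / y * ((x + y) / x + (x + y) / y)) := by ring
      _ ≤ 1 / 10 ^ 6 * scale n q (x + y) + 2 * 4 :=
          add_le_add (mul_le_mul_of_nonneg_right h1 (by linarith)) (by linarith)
      _ = _ := by ring
  calc x / y * c ≤ x / y * (2 * L * thresholdSq n q x y) :=
        mul_le_mul_of_nonneg_left hc2 hxy0.le
    _ = 2 * L * (x / y * thresholdSq n q x y) := by ring
    _ ≤ 2 * L * (1 / 10 ^ 6 * scale n q (x + y) + 8) := mul_le_mul_of_nonneg_left h4 (by linarith)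
    _ ≤ 3 / 10 ^ 6 * (L * scale n q (x + y)) := by nlinarith

end Optimality

/-! ### At most one estimated point in each cell -/

section NoSpurious

variable {n : ℕ} {L q : ℝ} {θ ε : Fin n → ℝ} {τ : Finset ℕ}

/-- Two consecutive points of an estimate around a jump: the left one cannot be much closer to the
jump than the right one. -/
theorem false_of_jump_near_left (hmin : IsPenalizedLSE L q (fun i => θ i + ε i) τ)
    (hε : NoiseBound ε q) (hq : 10 ^ 9 ≤ q) (hL : 10 ^ 8 ≤ L) {a s b w t₃ : ℕ} {r₁ r₂ : ℝ}
    (h₁ : Consec n τ a b) (h₂ : Consec n τ b t₃) (hb : b ∈ τ) (has : a < s) (hsb : s < b)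
    (hbw : b < w) (hθ₁ : ConstOn θ r₁ a s) (hθ₂ : ConstOn θ r₂ s w)
    (hw : w < t₃ → 2 * b ≤ s + w) (hnear : 10 ^ 6 * (s - a) ≤ b - s) : False := by
  have ha := h₁.one_le hmin.1
  have hab := h₁.lt
  have hbt := h₂.lt
  have ht₃ := h₂.le_succ hmin.1
  have hn1 : 0 < n := by
    have := Finset.mem_Icc.1 (hmin.1 hb)
    omega
  have hn : (0 : ℝ) < n := by exact_mod_cast hn1
  have hp : (0 : ℝ) < (s : ℝ) - a := by simpa using has
  have hr : (0 : ℝ) < (b : ℝ) - s := by simpa using hsb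
  have hz : (0 : ℝ) < (b : ℝ) - a := by linarith
  have hnear' : 10 ^ 6 * ((s : ℝ) - a) ≤ (b : ℝ) - s := by
    rw [← Nat.cast_sub has.le, ← Nat.cast_sub hsb.le]
    exact_mod_cast hnear
  have hzn : (s : ℝ) - a + ((b : ℝ) - s) ≤ n := by
    have : b ≤ n + a := by omega
    have : (b : ℝ) ≤ n + a := by exact_mod_cast this
    linarith
  have hc := sq_cusum_signal_le (θ := θ) hε (by linarith) ha has hsb (by omega)
  have hc2 := hmin.sq_cusum_le h₁ has hsb
  have hbias := bias_le hn1 hq hL hp hr hnear' hzn (hc.trans (by linarith))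
  rw [show (s : ℝ) - a + ((b : ℝ) - s) = (b : ℝ) - a by ring] at hbias
  have hs := scale_bounds (n := n) (q := q) (L := L) (by linarith) (by linarith) ha hab (by omega)
  rcases lt_or_ge w t₃ with hlt | hge
  · have hy0 : (0 : ℝ) < (w : ℝ) - b := by simpa using hbw
    have hw2 : 2 * (b : ℝ) ≤ s + w := by exact_mod_cast hw hlt
    refine hmin.false_of_right (by linarith) (by linarith) h₁ h₂ hb hbw hlt
      (by have := hw hlt; omega) ?_
    -- Since `s` is not selected inside `[a, b)`, its energy is at most of order `L` squared
    -- thresholds; seen from `b`, it is further damped by the ratio of the distances. So `b` is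
    -- treated as if the signal were constant around it.
    have hθb := sq_cusum_le_of_jump_left ha has hsb hbw (by omega) hθ₁ hθ₂
    have hY := sq_cusum_observation_le (θ := θ) hε (by linarith) ha hab hbw (by omega)
    have : thresholdSq n q ((b : ℝ) - a) ((w : ℝ) - b) ≤ scale n q ((b : ℝ) - a) + 2 * 3 := by
      refine thresholdSq_le_scale_add hn hz hy0 hz ?_
      have : ((b : ℝ) - a) / ((w : ℝ) - b) ≤ 2 := by
        rw [div_le_iff₀ hy0]
        linarith
      rw [div_self hz.ne']
      linarith
    nlinarith [hs.1, hs.2]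
  · have hθb := sq_cusum_le_of_jump_left ha has hsb hbt ht₃ hθ₁ (hθ₂.mono le_rfl hge)
    have hY := sq_cusum_observation_le (θ := θ) hε (by linarith) ha hab hbt ht₃
    have hrem := hmin.le_sq_cusum h₁ h₂ hb
    have hψ := le_thresholdSq q ha hab hbt ht₃
    have hbt0 : (0 : ℝ) < (t₃ : ℝ) - b := by simpa using hbt
    have hψ2 : scale n q ((b : ℝ) - a) ≤ thresholdSq n q ((b : ℝ) - a) ((t₃ : ℝ) - b) := by
      rw [thresholdSq_comm]
      exact scale_le_thresholdSq hn hbt0 hz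
    nlinarith [hs.1, hs.2, mul_le_mul_of_nonneg_left hψ2 (show 0 ≤ L by linarith)]

/-- The mirror image of `false_of_jump_near_left`. -/
theorem false_of_jump_near_right (hmin : IsPenalizedLSE L q (fun i => θ i + ε i) τ)
    (hε : NoiseBound ε q) (hq : 10 ^ 9 ≤ q) (hL : 10 ^ 8 ≤ L) {t₁ v a s b : ℕ} {r₁ r₂ : ℝ}
    (h₁ : Consec n τ t₁ a) (h₂ : Consec n τ a b) (ha : a ∈ τ) (hva : v < a) (has : a < s)
    (hsb : s < b) (hθ₁ : ConstOn θ r₁ v s) (hθ₂ : ConstOn θ r₂ s b)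
    (hv : t₁ < v → v + s ≤ 2 * a) (hnear : 10 ^ 6 * (b - s) ≤ s - a) : False := by
  have ht₁ := h₁.one_le hmin.1
  have hta := h₁.lt
  have hab := h₂.lt
  have hb := h₂.le_succ hmin.1
  have hn1 : 0 < n := by
    have := Finset.mem_Icc.1 (hmin.1 ha)
    omega
  have hn : (0 : ℝ) < n := by exact_mod_cast hn1
  have hp : (0 : ℝ) < (s : ℝ) - a := by simpa using has
  have hr : (0 : ℝ) < (b : ℝ) - s := by simpa using hsb
  have hz : (0 : ℝ) < (b : ℝ) - a := by linarith
  have hnear' : 10 ^ 6 * ((b : ℝ) - s) ≤ (s : ℝ) - a := by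
    rw [← Nat.cast_sub has.le, ← Nat.cast_sub hsb.le]
    exact_mod_cast hnear
  have hzn : (b : ℝ) - s + ((s : ℝ) - a) ≤ n := by
    have : b ≤ n + a := by omega
    have : (b : ℝ) ≤ n + a := by exact_mod_cast this
    linarith
  have hc := sq_cusum_signal_le (θ := θ) hε (by linarith) (by omega) has hsb (by omega)
  have hc2 := hmin.sq_cusum_le h₂ has hsb
  rw [thresholdSq_comm] at hc hc2
  have hbias := bias_le hn1 hq hL hr hp hnear' hzn (hc.trans (by linarith))
  rw [show (b : ℝ) - s + ((s : ℝ) - a) = (b : ℝ) - a by ring] at hbias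
  have hs := scale_bounds (n := n) (q := q) (L := L) (by linarith) (by linarith)
    (by omega) hab (by omega)
  rcases lt_or_ge t₁ v with hlt | hge
  · have hy0 : (0 : ℝ) < (a : ℝ) - v := by simpa using hva
    have hv2 : (v : ℝ) + s ≤ 2 * a := by exact_mod_cast hv hlt
    refine hmin.false_of_left (by linarith) (by linarith) h₁ h₂ ha hlt hva
      (by have := hv hlt; omega) ?_
    have hθb := sq_cusum_le_of_jump_right (by omega) hva has hsb hb hθ₁ hθ₂
    have hY := sq_cusum_observation_le (θ := θ) hε (by linarith) (by omega) hva hab hb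
    have : thresholdSq n q ((a : ℝ) - v) ((b : ℝ) - a) ≤ scale n q ((b : ℝ) - a) + 2 * 3 := by
      refine thresholdSq_le_scale_add hn hy0 hz hz ?_
      have : ((b : ℝ) - a) / ((a : ℝ) - v) ≤ 2 := by
        rw [div_le_iff₀ hy0]
        linarith
      rw [div_self hz.ne']
      linarith
    nlinarith [hs.1, hs.2]
  · have hθb := sq_cusum_le_of_jump_right ht₁ hta has hsb hb (hθ₁.mono hge le_rfl) hθ₂
    have hY := sq_cusum_observation_le (θ := θ) hε (by linarith) ht₁ hta hab hb
    have hrem := hmin.le_sq_cusum h₁ h₂ ha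
    have hψ := le_thresholdSq q ht₁ hta hab hb
    have hta0 : (0 : ℝ) < (a : ℝ) - t₁ := by simpa using hta
    have hψ2 : scale n q ((b : ℝ) - a) ≤ thresholdSq n q ((a : ℝ) - t₁) ((b : ℝ) - a) :=
      scale_le_thresholdSq hn hta0 hz
    nlinarith [hs.1, hs.2, mul_le_mul_of_nonneg_left hψ2 (show 0 ≤ L by linarith)]

/-- The gains from removing the point `a`, or moving it to `v`, once a jump `s` on its right has
been inserted. -/
theorem gain_left (hmin : IsPenalizedLSE L q (fun i => θ i + ε i) τ)
    (hε : NoiseBound ε q) (hq : 10 ^ 8 ≤ q) (hL : 10 ^ 8 ≤ L) {t₁ v a s : ℕ} {r : ℝ}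
    (h₁ : Consec n τ t₁ a) (hva : v < a) (has : a < s) (hs : s ≤ n + 1) (hθ : ConstOn θ r v s)
    (hv : t₁ < v → v + s ≤ 2 * a) {Y : Fin n → ℝ} (hY : Y = fun i => θ i + ε i) {G₁ G₂ W : ℝ}
    (hG₁ : G₁ = segCost L q Y t₁ a + segCost L q Y a s - segCost L q Y t₁ s)
    (hG₂ : G₂ = segCost L q Y t₁ a + segCost L q Y a s -
      (segCost L q Y t₁ v + segCost L q Y v s)) (hW : W = L * scale n q ((s : ℝ) - a)) :
    0.6 * W ≤ G₁ ∨ (t₁ < v ∧ 0.6 * W ≤ G₂) ∨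
      (t₁ < v ∧ (a : ℝ) - v ≤ 2 * ((s : ℝ) - a) ∧ ∃ E, W - E - 0.02 * W ≤ G₁ ∧ E - 0.02 * W ≤ G₂)
    := by
  have ht₁ := h₁.one_le hmin.1
  have hta := h₁.lt
  have hn1 : 1 ≤ n := by omega
  have hn : (0 : ℝ) < n := by exact_mod_cast hn1
  have hL0 : 0 < L := by linarith
  have hz0 : (0 : ℝ) < (s : ℝ) - a := by simpa using has
  have hsb := scale_bounds (n := n) (q := q) (L := L) (by linarith) (by linarith)
    (by omega) has hs
  rw [segCost_add_segCost L q Y hn1 hta has] at hG₁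
  rcases lt_or_ge t₁ v with hlt | hge
  · have hx0 : (0 : ℝ) < (v : ℝ) - t₁ := by simpa using hlt
    have hy0 : (0 : ℝ) < (a : ℝ) - v := by simpa using hva
    have hzn : (s : ℝ) - a ≤ n := by
      have : s ≤ n + a := by omega
      have : (s : ℝ) ≤ n + a := by exact_mod_cast this
      linarith
    have hyz : (s : ℝ) - a ≤ (a : ℝ) - v := by
      have : (v : ℝ) + s ≤ 2 * a := by exact_mod_cast hv hlt
      linarith
    have hν := hε.sq_cusum_le_of_const (by linarith) (by omega) hva has hs hθ
    rw [← hY] at hν hmin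
    have he := hmin.sq_cusum_le h₁ hlt hva
    have hψ : thresholdSq n q ((a : ℝ) - v) ((s : ℝ) - a) ≤ scale n q ((s : ℝ) - a) + 2 * 2 := by
      refine thresholdSq_le_scale_add hn hy0 hz0 hz0 ?_
      have : ((s : ℝ) - a) / ((a : ℝ) - v) ≤ 1 := (div_le_one hy0).2 (by linarith)
      rw [div_self hz0.ne']
      linarith
    have key := gain_large hn hq hL0 hx0 hy0 hz0 hzn (hν.trans (by nlinarith [hsb.1])) he
      (cusum_left Y hlt hva has) hyz
    have d1 := segCost_add_segCost L q Y hn1 hva has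
    have d2 := segCost_add_segCost L q Y hn1 hlt hva
    rw [show (v : ℝ) - t₁ + ((a : ℝ) - v) = (a : ℝ) - t₁ by ring, ← hG₁, ← hW] at key
    rcases key with key | key | ⟨k1, k2, k3⟩
    · exact Or.inl key
    · exact Or.inr (Or.inl ⟨hlt, by linarith⟩)
    -- The witness `E` is `cusum Y t₁ v a ^ 2`.
    · exact Or.inr (Or.inr ⟨hlt, k1, _, k2, by linarith⟩)
  · left
    have hν := hε.sq_cusum_le_of_const (by linarith) ht₁ hta has hs (hθ.mono hge le_rfl)
    rw [← hY] at hν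
    have hψ := scale_le_thresholdSq (q := q) hn (show (0 : ℝ) < (a : ℝ) - t₁ by simpa using hta) hz0
    nlinarith [hsb.1, mul_le_mul_of_nonneg_left hψ hL0.le]

/-- The mirror image of `gain_left`. -/
theorem gain_right (hmin : IsPenalizedLSE L q (fun i => θ i + ε i) τ)
    (hε : NoiseBound ε q) (hq : 10 ^ 8 ≤ q) (hL : 10 ^ 8 ≤ L) {s b w t₃ : ℕ} {r : ℝ}
    (h₂ : Consec n τ b t₃) (hbw : b < w) (hsb : s < b) (hs : 1 ≤ s) (hθ : ConstOn θ r s w)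
    (hw : w < t₃ → 2 * b ≤ s + w) {Y : Fin n → ℝ} (hY : Y = fun i => θ i + ε i) {G₁ G₂ W : ℝ}
    (hG₁ : G₁ = segCost L q Y s b + segCost L q Y b t₃ - segCost L q Y s t₃)
    (hG₂ : G₂ = segCost L q Y s b + segCost L q Y b t₃ -
      (segCost L q Y s w + segCost L q Y w t₃)) (hW : W = L * scale n q ((b : ℝ) - s)) :
    0.6 * W ≤ G₁ ∨ (w < t₃ ∧ 0.6 * W ≤ G₂) ∨
      (w < t₃ ∧ (w : ℝ) - b ≤ 2 * ((b : ℝ) - s) ∧ ∃ E, W - E - 0.02 * W ≤ G₁ ∧ E - 0.02 * W ≤ G₂)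
    := by
  have ht₃ := h₂.le_succ hmin.1
  have hbt := h₂.lt
  have hn1 : 1 ≤ n := by omega
  have hn : (0 : ℝ) < n := by exact_mod_cast hn1
  have hL0 : 0 < L := by linarith
  have hz0 : (0 : ℝ) < (b : ℝ) - s := by simpa using hsb
  have hsc := scale_bounds (n := n) (q := q) (L := L) (by linarith) (by linarith)
    hs hsb (by omega)
  rw [segCost_add_segCost L q Y hn1 hsb hbt, thresholdSq_comm] at hG₁
  rcases lt_or_ge w t₃ with hlt | hge
  · have hx0 : (0 : ℝ) < (t₃ : ℝ) - w := by simpa using hlt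
    have hy0 : (0 : ℝ) < (w : ℝ) - b := by simpa using hbw
    have hzn : (b : ℝ) - s ≤ n := by
      have : b ≤ n + s := by omega
      have : (b : ℝ) ≤ n + s := by exact_mod_cast this
      linarith
    have hyz : (b : ℝ) - s ≤ (w : ℝ) - b := by
      have : 2 * (b : ℝ) ≤ s + w := by exact_mod_cast hw hlt
      linarith
    have hν := hε.sq_cusum_le_of_const (by linarith) hs hsb hbw (by omega) hθ
    rw [← hY] at hν hmin
    have he := hmin.sq_cusum_le h₂ hbw hlt
    have hψ : thresholdSq n q ((b : ℝ) - s) ((w : ℝ) - b) ≤ scale n q ((b : ℝ) - s) + 2 * 2 := by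
      refine thresholdSq_le_scale_add hn hz0 hy0 hz0 ?_
      have : ((b : ℝ) - s) / ((w : ℝ) - b) ≤ 1 := (div_le_one hy0).2 (by linarith)
      rw [div_self hz0.ne']
      linarith
    rw [thresholdSq_comm] at he
    have key := gain_large hn hq hL0 hx0 hy0 hz0 hzn (hν.trans (by nlinarith [hsc.1])) he
      (cusum_right Y hsb hbw hlt) hyz
    have d1 := segCost_add_segCost L q Y hn1 hsb hbw
    have d2 := segCost_add_segCost L q Y hn1 hbw hlt
    rw [thresholdSq_comm] at d1 d2
    rw [show (t₃ : ℝ) - w + ((w : ℝ) - b) = (t₃ : ℝ) - b by ring, ← hG₁, ← hW] at key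
    rcases key with key | key | ⟨k1, k2, k3⟩
    · exact Or.inl key
    · exact Or.inr (Or.inl ⟨hlt, by linarith⟩)
    · exact Or.inr (Or.inr ⟨hlt, k1, _, k2, by linarith⟩)
  · left
    have hν := hε.sq_cusum_le_of_const (by linarith) hs hsb hbt ht₃ (hθ.mono le_rfl hge)
    rw [← hY, thresholdSq_comm] at hν
    have hψ := scale_le_thresholdSq (q := q) hn (show (0 : ℝ) < (t₃ : ℝ) - b by simpa using hbt) hz0
    nlinarith [hsc.1, mul_le_mul_of_nonneg_left hψ hL0.le]

theorem scale_anti {n q x y : ℝ} (hn : 0 < n) (hx : 0 < x) (hxy : x ≤ y) :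
    scale n q y ≤ scale n q x := by
  unfold scale
  have : Real.log (n / y) ≤ Real.log (n / x) :=
    Real.log_le_log (div_pos hn (by linarith)) (div_le_div_of_nonneg_left hn.le hx hxy)
  linarith

theorem mul_div_add_mono {x y x' y' : ℝ} (hx : 0 < x) (hy : 0 < y) (hxx' : x ≤ x')
    (hyy' : y ≤ y') : x * y / (x + y) ≤ x' * y' / (x' + y') := by
  have hx' : 0 < x' := by linarith
  have hy' : 0 < y' := by linarith
  rw [div_le_div_iff₀ (by positivity) (by positivity)]
  have h1 : x * x' * y ≤ x * x' * y' := mul_le_mul_of_nonneg_left hyy' (by positivity)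
  have h2 : y * y' * x ≤ y * y' * x' := mul_le_mul_of_nonneg_left hxx' (by positivity)
  nlinarith

/-- Two consecutive points of an estimate cannot surround a jump at comparable distances. -/
theorem false_of_jump_between (hmin : IsPenalizedLSE L q (fun i => θ i + ε i) τ)
    (hε : NoiseBound ε q) (hq : 10 ^ 9 ≤ q) (hL : 10 ^ 8 ≤ L) {t₁ v a s b w t₃ : ℕ} {r₁ r₂ : ℝ}
    (h₁ : Consec n τ t₁ a) (h₂ : Consec n τ a b) (h₃ : Consec n τ b t₃) (ha : a ∈ τ) (hb : b ∈ τ)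
    (hva : v < a) (has : a < s) (hsb : s < b) (hbw : b < w)
    (hθ₁ : ConstOn θ r₁ v s) (hθ₂ : ConstOn θ r₂ s w)
    (hv : t₁ < v → v + s ≤ 2 * a) (hw : w < t₃ → 2 * b ≤ s + w)
    (hnear : b - s ≤ 10 ^ 6 * (s - a)) (hnear' : s - a ≤ 10 ^ 6 * (b - s)) : False := by
  have ht₁ := h₁.one_le hmin.1
  have hta := h₁.lt
  have hbt := h₃.lt
  have ht₃ := h₃.le_succ hmin.1
  have hL0 : 0 < L := by linarith
  have hn1 : 1 ≤ n := by omega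
  have hn : (0 : ℝ) < n := by exact_mod_cast hn1
  have hp0 : (0 : ℝ) < (s : ℝ) - a := by simpa using has
  have hr0 : (0 : ℝ) < (b : ℝ) - s := by simpa using hsb
  have hnear₁ : (b : ℝ) - s ≤ 10 ^ 6 * ((s : ℝ) - a) := by
    rw [← Nat.cast_sub has.le, ← Nat.cast_sub hsb.le]
    exact_mod_cast hnear
  have hnear₂ : (s : ℝ) - a ≤ 10 ^ 6 * ((b : ℝ) - s) := by
    rw [← Nat.cast_sub has.le, ← Nat.cast_sub hsb.le]
    exact_mod_cast hnear'
  obtain ⟨Y, hY⟩ : ∃ Y : Fin n → ℝ, Y = fun i => θ i + ε i := ⟨_, rfl⟩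
  have hexch : ∀ l : List ℕ, List.IsChain (· < ·) (t₁ :: (l ++ [t₃])) →
      segCost L q Y t₁ a + (segCost L q Y a b + segCost L q Y b t₃) ≤
        chainCost L q Y t₁ l t₃ := by
    intro l hl
    rw [hY]
    refine hmin.chainCost_le (l₀ := [a, b]) h₁.left h₃.right (by simp; omega)
      (by simp [ha, hb]) ?_ hl
    intro x hx hx₁ hx₃
    rcases (h₁.gap x hx hx₁).eq_or_lt with h | h
    · simp [h]
    rcases (h₂.gap x hx h).eq_or_lt with h | h
    · simp [h]
    · exact absurd (h₃.gap x hx h) (by omega)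
  have gl := gain_left hmin hε (by linarith) hL h₁ hva has (by omega) hθ₁ hv hY rfl rfl rfl
  have gr := gain_right hmin hε (by linarith) hL h₃ hbw hsb (by omega) hθ₂ hw hY rfl rfl rfl
  have dasb := segCost_add_segCost L q Y hn1 has hsb
  -- All exchanges insert `s`, with `a` removed or moved to `v` and `b` removed or moved to `w`; the
  -- exception is `xvw`, which only moves both points.
  have x11 := hexch [s] (by simp; omega)
  have x21 : t₁ < v → _ := fun h => hexch [v, s] (by simp; omega)
  have x12 : w < t₃ → _ := fun h => hexch [s, w] (by simp; omega)
  have x22 : t₁ < v → w < t₃ → _ := fun h h' => hexch [v, s, w] (by simp; omega)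
  have xvw : t₁ < v → w < t₃ → _ := fun h h' => hexch [v, w] (by simp; omega)
  simp only [chainCost] at x11 x12 x21 x22 xvw
  -- the scales at `a`, `b` and `s` agree up to a small factor
  obtain ⟨z, hz⟩ : ∃ z, z = max ((s : ℝ) - a) ((b : ℝ) - s) := ⟨_, rfl⟩
  have hpz : (s : ℝ) - a ≤ z := hz ▸ le_max_left _ _
  have hrz : (b : ℝ) - s ≤ z := hz ▸ le_max_right _ _
  have hz0 : 0 < z := by linarith
  have hzn : z ≤ n := by
    have h1 : b ≤ n + s := by omega
    have h1 : (b : ℝ) ≤ n + s := by exact_mod_cast h1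
    have h2 : s ≤ n + a := by omega
    have h2 : (s : ℝ) ≤ n + a := by exact_mod_cast h2
    rw [hz]
    exact max_le (by linarith) (by linarith)
  have hW0 := le_scale (q := q) hz0 hzn
  have hψz : thresholdSq n q ((s : ℝ) - a) ((b : ℝ) - s) ≤ scale n q z + 2 * (2 * 10 ^ 6) := by
    refine thresholdSq_le_scale_add hn hp0 hr0 hz0 ?_
    have h1 : z / ((s : ℝ) - a) ≤ 10 ^ 6 := by
      rw [div_le_iff₀ hp0, hz]
      exact max_le (by linarith) hnear₁
    have h2 : z / ((b : ℝ) - s) ≤ 10 ^ 6 := by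
      rw [div_le_iff₀ hr0, hz]
      exact max_le hnear₂ (by linarith)
    linarith
  have hψ1 : thresholdSq n q ((s : ℝ) - a) ((b : ℝ) - s) ≤ 1.01 * scale n q z := by linarith
  have hWl := mul_le_mul_of_nonneg_left (scale_anti (q := q) hn hp0 hpz) hL0.le
  have hWr := mul_le_mul_of_nonneg_left (scale_anti (q := q) hn hr0 hrz) hL0.le
  have hWr' := mul_le_mul_of_nonneg_left
    ((scale_le_thresholdSq (q := q) hn hp0 hr0).trans hψ1) hL0.le
  have hWl' := mul_le_mul_of_nonneg_left
    ((scale_le_thresholdSq (q := q) hn hr0 hp0).trans (thresholdSq_comm.trans_le hψ1)) hL0.le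
  have hψL := mul_le_mul_of_nonneg_left hψ1 hL0.le
  have hWpos : 10 ^ 9 * L ≤ L * scale n q z := by
    rw [mul_comm]
    exact mul_le_mul_of_nonneg_left (hq.trans hW0) hL0.le
  have hWs : 10 ^ 8 * scale n q z ≤ L * scale n q z :=
    mul_le_mul_of_nonneg_right hL (by linarith)
  set W := L * scale n q z with hW
  set Wl := L * scale n q ((s : ℝ) - a) with hWl_def
  set Wr := L * scale n q ((b : ℝ) - s) with hWr_def
  have hc0 := sq_nonneg (cusum Y a s b)
  rw [mul_left_comm, ← hW] at hWl' hWr' hψL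
  -- Inserting `s` costs at most `1.01 * W`. A good side gains `0.6 * W`, and an exceptional side
  -- gains at least `0.48` times its own scale by one of its two options. Hence a single good side
  -- suffices for a contradiction.
  rcases gl with gl | ⟨hlv, gl⟩ | ⟨hlv, hy, El, gl1, gl2⟩
  · rcases gr with gr | ⟨hrw, gr⟩ | ⟨hrw, hy', Er, gr1, gr2⟩
    · linarith
    · linarith [x12 hrw]
    · linarith [x12 hrw]
  · rcases gr with gr | ⟨hrw, gr⟩ | ⟨hrw, hy', Er, gr1, gr2⟩
    · linarith [x21 hlv]
    · linarith [x22 hlv hrw]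
    · linarith [x22 hlv hrw, x21 hlv]
  · rcases gr with gr | ⟨hrw, gr⟩ | ⟨hrw, hy', Er, gr1, gr2⟩
    · linarith [x21 hlv]
    · linarith [x12 hrw, x22 hlv hrw]
    -- Both sides are exceptional. Adding `x11` and `e22` shows that inserting `s` costs at least
    -- about `0.96 * W`, so the jump has low energy at `(a, s, b)`. The distances to `v` and `w` are
    -- at most three times those to `a` and `b`, so its energy is also low at `(v, s, w)`. Having no
    -- point at `s` then saves nearly `W` against `[v, s, w]`, which contradicts `evw`.
    · have e22 := x22 hlv hrw
      have evw := xvw hlv hrw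
      have hvs : v < s := by omega
      have hsw : s < w := by omega
      have dvsw := segCost_add_segCost L q Y hn1 hvs hsw
      have hw1 : w ≤ n + 1 := by omega
      have hX : (s : ℝ) - v ≤ 3 * ((s : ℝ) - a) := by linarith
      have hX' : (w : ℝ) - s ≤ 3 * ((b : ℝ) - s) := by linarith
      have hX0 : (0 : ℝ) < (s : ℝ) - v := by simpa using hvs
      have hX0' : (0 : ℝ) < (w : ℝ) - s := by simpa using hsw
      have hlow : thresholdSq n q ((s : ℝ) - a) ((b : ℝ) - s) - 6 ≤
          thresholdSq n q ((s : ℝ) - v) ((w : ℝ) - s) := by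
        have h1 := thresholdSq_anti (q := q) hn hX0 hX0' hX hX'
        have h2 : thresholdSq n q (3 * ((s : ℝ) - a)) (3 * ((b : ℝ) - s)) =
            thresholdSq n q ((s : ℝ) - a) ((b : ℝ) - s) - 2 * Real.log 3 := by
          unfold thresholdSq
          rw [show ∀ x y : ℝ, (n : ℝ) * (3 * x + 3 * y) / (3 * x * (3 * y)) =
              n * (x + y) / (x * y) / 3 by intros; field_simp,
            Real.log_div (by positivity) (by norm_num)]
          ring
        have h3 := Real.log_le_sub_one_of_pos (show (0 : ℝ) < 3 by norm_num)
        linarith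
      have hup : thresholdSq n q ((s : ℝ) - v) ((w : ℝ) - s) ≤ 1.01 * scale n q z :=
        (thresholdSq_anti hn hp0 hr0 (by
          have : (v : ℝ) ≤ a := by exact_mod_cast hva.le
          linarith) (by
          have : (b : ℝ) ≤ w := by exact_mod_cast hbw.le
          linarith)).trans hψ1
      have hv1 : 1 ≤ v := by omega
      have c1 := sq_cusum_observation_le (θ := θ) hε (by linarith) hv1 hvs hsw hw1
      have c2 := sq_cusum_signal_le (θ := θ) hε (by linarith) (by omega) has hsb (by omega)
      rw [← hY] at c1 c2
      have c3 : cusum θ v s w ^ 2 ≤ 3 * cusum θ a s b ^ 2 := by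
        rw [sq_cusum_of_jump hv1 hvs hsw hw1 hθ₁ hθ₂, sq_cusum_of_jump (by omega) has hsb (by omega)
          (hθ₁.mono hva.le le_rfl) (hθ₂.mono le_rfl hbw.le), mul_left_comm]
        refine mul_le_mul_of_nonneg_left ((mul_div_add_mono hX0 hX0' hX hX').trans (le_of_eq ?_))
          (sq_nonneg _)
        field_simp
      have c4 : thresholdSq n q ((s : ℝ) - v) ((w : ℝ) - s) * 10 ^ 8 ≤ 1.01 * W := by linarith only [hWs, hup]
      have c5 : thresholdSq n q ((s : ℝ) - a) ((b : ℝ) - s) * 10 ^ 8 ≤ 1.01 * W := by linarith only [hWs, hψ1]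
      have c6 := mul_le_mul_of_nonneg_left hlow hL0.le
      linarith

/-- Two consecutive points of an estimate cannot lie in the same cell around a change-point. -/
theorem false_of_cell (hmin : IsPenalizedLSE L q (fun i => θ i + ε i) τ)
    (hε : NoiseBound ε q) (hq : 10 ^ 9 ≤ q) (hL : 10 ^ 8 ≤ L) {v a s b w : ℕ} {r₁ r₂ : ℝ}
    (h₂ : Consec n τ a b) (ha : a ∈ τ) (hb : b ∈ τ) (hvs : v < s) (hsw : s < w)
    (hθ₁ : ConstOn θ r₁ v s) (hθ₂ : ConstOn θ r₂ s w)
    (hv : v = 1 ∨ v + s ≤ 2 * a) (hw : w = n + 1 ∨ 2 * b ≤ s + w) : False := by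
  have ha2 := Finset.mem_Icc.1 (hmin.1 ha)
  have hb2 := Finset.mem_Icc.1 (hmin.1 hb)
  obtain ⟨t₁, h₁⟩ := exists_consec_left hmin.1 ha
  have h₃ := consec_nextPoint (by omega) hmin.1 (Finset.mem_insert_of_mem hb)
  set t₃ := nextPoint n τ b
  have ht₁ := h₁.one_le hmin.1
  have ht₃ := h₃.le_succ hmin.1
  -- In an extreme cell `v = 1` or `w = n + 1`. Then `t₁ < v` or `w < t₃` is impossible, so the
  -- distance conditions of the lemmas below hold vacuously.
  have hva : v < a := by omega
  have hbw : b < w := by omega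
  have hab := h₂.lt
  rcases le_or_gt b s with hbs | hsb
  · exact false_of_const_left hmin hε (by linarith) hL h₁ h₂ ha hva (hθ₁.mono le_rfl hbs)
      (fun h => by omega)
  rcases le_or_gt s a with hsa | has
  · exact false_of_const_right hmin hε (by linarith) hL h₂ h₃ hb hbw (hθ₂.mono hsa le_rfl)
      (fun h => by omega)
  rcases le_total (10 ^ 6 * (s - a)) (b - s) with hn | hn
  · exact false_of_jump_near_left hmin hε hq hL h₂ h₃ hb has hsb hbw (hθ₁.mono hva.le le_rfl) hθ₂
      (fun h => by omega) hn
  rcases le_total (10 ^ 6 * (b - s)) (s - a) with hn' | hn'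
  · exact false_of_jump_near_right hmin hε hq hL h₁ h₂ ha hva has hsb hθ₁ (hθ₂.mono le_rfl hbw.le)
      (fun h => by omega) hn'
  · exact false_of_jump_between hmin hε hq hL h₁ h₂ h₃ ha hb hva has hsb hbw hθ₁ hθ₂
      (fun h => by omega) (fun h => by omega) hn hn'

end NoSpurious

/-! ### The three claims on the noise event -/

section Deterministic

variable {n : ℕ} {L q : ℝ} {θ ε : Fin n → ℝ} {τ : Finset ℕ} {K : ℕ} {τs : ℕ → ℕ} {μ : ℕ → ℝ}

theorem HasChangePoints.one_le (h : HasChangePoints θ K τs μ) {j : ℕ} (hj : j ≤ K + 1) :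
    1 ≤ τs j := by
  induction j with
  | zero => rw [h.first]
  | succ j ih =>
    have := h.lt_succ j (by omega)
    have := ih (by omega)
    omega

theorem HasChangePoints.le_succ (h : HasChangePoints θ K τs μ) {j : ℕ} (hj : j ≤ K + 1) :
    τs j ≤ n + 1 := by
  induction hj using Nat.decreasingInduction with
  | self => rw [h.last]
  | of_succ j hj ih => exact (h.lt_succ j (by omega)).le.trans ih

theorem HasChangePoints.constOn_left (h : HasChangePoints θ K τs μ) {k : ℕ}
    (hk : k ∈ Finset.Icc 1 K) : ConstOn θ (μ k) (τs (k - 1)) (τs k) := by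
  rw [Finset.mem_Icc] at hk
  exact h.value k (Finset.mem_Icc.2 ⟨hk.1, by omega⟩)

theorem HasChangePoints.constOn_right (h : HasChangePoints θ K τs μ) {k : ℕ}
    (hk : k ∈ Finset.Icc 1 K) : ConstOn θ (μ (k + 1)) (τs k) (τs (k + 1)) := by
  rw [Finset.mem_Icc] at hk
  exact h.value (k + 1) (Finset.mem_Icc.2 ⟨by omega, by omega⟩)

theorem HasChangePoints.lt_left (h : HasChangePoints θ K τs μ) {k : ℕ}
    (hk : k ∈ Finset.Icc 1 K) : τs (k - 1) < τs k := by
  rw [Finset.mem_Icc] at hk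
  have := h.lt_succ (k - 1) (by omega)
  rwa [Nat.sub_add_cancel hk.1] at this

theorem HasChangePoints.lt_right (h : HasChangePoints θ K τs μ) {k : ℕ}
    (hk : k ∈ Finset.Icc 1 K) : τs k < τs (k + 1) :=
  h.lt_succ k (Finset.mem_Icc.1 hk).2

theorem HasChangePoints.mem_Icc (h : HasChangePoints θ K τs μ) {k : ℕ}
    (hk : k ∈ Finset.Icc 1 K) : τs k ∈ Finset.Icc 2 n := by
  have h1 := h.lt_left hk
  have h2 := h.lt_right hk
  rw [Finset.mem_Icc] at hk ⊢
  have h3 := h.one_le (j := k - 1) (by omega)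
  have h4 := h.le_succ (j := k + 1) (by omega)
  omega

/-- A penalized least-squares estimate has no spurious point, on the noise event. -/
theorem noSp_of_isPenalizedLSE (hθ : HasChangePoints θ K τs μ)
    (hmin : IsPenalizedLSE L q (fun i => θ i + ε i) τ) (hε : NoiseBound ε q) (hq : 10 ^ 9 ≤ q)
    (hL : 10 ^ 8 ≤ L) : NoSp K τs τ := by
  intro k hk
  by_contra hcard
  have hcard := not_le.1 hcard
  have hfin : {u ∈ (τ : Set ℕ) | (k = 1 ∨ ((τs (k - 1) : ℝ) + τs k) / 2 < u) ∧
      (k = K ∨ (u : ℝ) ≤ ((τs k : ℝ) + τs (k + 1)) / 2)}.Finite :=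
    τ.finite_toSet.subset (Set.sep_subset _ _)
  rw [Set.one_lt_ncard hfin] at hcard
  obtain ⟨a, ha, c, hc, hac⟩ := hcard
  wlog hlt : a < c generalizing a c
  · exact this c hc a ha hac.symm (lt_of_le_of_ne (not_lt.1 hlt) hac.symm)
  obtain ⟨haτ, haL, -⟩ := ha
  obtain ⟨hcτ, -, hcR⟩ := hc
  have haτ : a ∈ τ := haτ
  have hcτ : c ∈ τ := hcτ
  have hn : 1 ≤ n := by
    have := Finset.mem_Icc.1 (hmin.1 haτ)
    omega
  have hab := consec_nextPoint hn hmin.1 (Finset.mem_insert_of_mem haτ)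
  -- The second point of the cell may be replaced by the successor of the first one: it is not
  -- farther right, so it still satisfies the right-hand condition of the cell.
  set b := nextPoint n τ a
  have hbc : b ≤ c := hab.gap c hcτ hlt
  have hbτ : b ∈ τ := by
    rcases Finset.mem_insert.1 hab.right with h | h
    · have := Finset.mem_Icc.1 (hmin.1 hcτ)
      omega
    · exact h
  refine false_of_cell hmin hε hq hL hab haτ hbτ (hθ.lt_left hk) (hθ.lt_right hk)
    (hθ.constOn_left hk) (hθ.constOn_right hk) ?_ ?_
  · rcases haL with h | h
    · left
      rw [h]
      exact hθ.first
    · right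
      have : (τs (k - 1) : ℝ) + τs k ≤ 2 * a := by linarith
      exact_mod_cast this
  · rcases hcR with h | h
    · left
      rw [h]
      exact hθ.last
    · right
      have hbc' : (b : ℝ) ≤ c := by exact_mod_cast hbc
      have : 2 * (b : ℝ) ≤ τs k + τs (k + 1) := by linarith
      exact_mod_cast this

/-- A change-point that is not a point of the estimate has low energy with respect to it. -/
theorem not_isHighEnergyIn_of_isPenalizedLSE (hmin : IsPenalizedLSE L q (fun i => θ i + ε i) τ)
    (hε : NoiseBound ε q) (hL : 0 ≤ L) {s : ℕ} (hs : s ∈ Finset.Icc 2 n)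
    (hsτ : s ∉ τ) : ¬ IsHighEnergyIn θ (√L + 2) q (insert s τ) s := by
  obtain ⟨t₁, t₃, hc, h₁, h₃⟩ := exists_consec hmin.1 hs hsτ
  have hτ' : insert s τ ⊆ Finset.Icc 2 n := Finset.insert_subset hs hmin.1
  have ht₁ := hc.one_le hmin.1
  have ht₃ := hc.le_succ hmin.1
  unfold IsHighEnergyIn IsHighEnergy energy
  rw [(hc.insert_left h₁ h₃).prevPoint_eq hτ' h₁ le_rfl,
    (hc.insert_right h₁ h₃).nextPoint_eq hτ', not_lt]
  have hY := hmin.sq_cusum_le hc h₁ h₃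
  have hε' := hε t₁ s t₃ ht₁ h₁ h₃ ht₃
  have hY' : |cusum (fun i => θ i + ε i) t₁ s t₃| ≤ √L * threshold n q t₁ s t₃ := by
    rw [threshold_eq, ← Real.sqrt_mul hL]
    exact Real.abs_le_sqrt hY
  have : cusum θ t₁ s t₃ = cusum (fun i => θ i + ε i) t₁ s t₃ - cusum ε t₁ s t₃ := by
    rw [cusum_add]
    ring
  rw [this]
  have := abs_sub (cusum (fun i => θ i + ε i) t₁ s t₃) (cusum ε t₁ s t₃)
  linarith

/-! ### Detection of high-energy change-points -/

/-- The observations have low energy at every triad with sides of length at least `e` that refines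
a pair of consecutive points of the estimate. -/
theorem sq_cusum_le_of_refine {Y : Fin n → ℝ} (hmin : IsPenalizedLSE L q Y τ) (hL : 0 ≤ L)
    (hq : 0 ≤ q) {t₁ t₃ l s h e : ℕ} (hc : Consec n τ t₁ t₃) (he : 1 ≤ e)
    (hl : l = t₁ ∨ t₁ + e ≤ l) (hls : l + e ≤ s) (hsh : s + e ≤ h) (hh : h = t₃ ∨ h + e ≤ t₃) :
    cusum Y l s h ^ 2 ≤ 3 * (L * thresholdSq n q e e) := by
  have ht₁ := hc.one_le hmin.1
  have ht₃ := hc.le_succ hmin.1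
  have hn1 : 1 ≤ n := by omega
  have hn : (0 : ℝ) < n := by exact_mod_cast hn1
  have he0 : (0 : ℝ) < e := by exact_mod_cast he
  have hanti : ∀ {u x w : ℕ}, u + e ≤ x → x + e ≤ w →
      L * thresholdSq n q ((x : ℝ) - u) ((w : ℝ) - x) ≤ L * thresholdSq n q e e := by
    intro u x w hux hxw
    have h1 : (u : ℝ) + e ≤ x := by exact_mod_cast hux
    have h2 : (x : ℝ) + e ≤ w := by exact_mod_cast hxw
    exact mul_le_mul_of_nonneg_left
      (thresholdSq_anti hn he0 he0 (by linarith) (by linarith)) hL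
  have hexch : ∀ l : List ℕ, List.IsChain (· < ·) (t₁ :: (l ++ [t₃])) →
      segCost L q Y t₁ t₃ ≤ chainCost L q Y t₁ l t₃ := fun l hl =>
    hmin.chainCost_le (l₀ := []) hc.left hc.right (by simpa using hc.lt) (by simp)
      (fun x hx hx₁ hx₃ => absurd (hc.gap x hx hx₁) (by omega)) hl
  have hpos : 0 ≤ L * thresholdSq n q e e := by
    refine le_trans ?_ (hanti hls hsh)
    exact mul_nonneg hL (hq.trans (le_thresholdSq q (by omega) (by omega) (by omega) (by omega)))
  -- At most three points are inserted, each at a penalty of at most `L` times the threshold at `(e,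
  -- e)`. The gains from `l` and `h` are nonnegative and are dropped.
  have a1 := hanti hls hsh
  have d1 := segCost_add_segCost L q Y hn1 (show l < s by omega) (show s < h by omega)
  rcases hl with rfl | hl
  · rcases hh with rfl | hh
    · have := hexch [s] (by simp; omega)
      simp only [chainCost] at this
      linarith
    · have := hexch [s, h] (by simp; omega)
      simp only [chainCost] at this
      have d2 := segCost_add_segCost L q Y hn1 (show l < h by omega) (show h < t₃ by omega)
      have a2 := hanti (show l + e ≤ h by omega) hh
      have := sq_nonneg (cusum Y l h t₃)
      linarith
  · have d2 := segCost_add_segCost L q Y hn1 (show t₁ < l by omega) (show l < t₃ by omega)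
    have a2 := hanti hl (show l + e ≤ t₃ by omega)
    have := sq_nonneg (cusum Y t₁ l t₃)
    rcases hh with rfl | hh
    · have := hexch [l, s] (by simp; omega)
      simp only [chainCost] at this
      linarith
    · have := hexch [l, s, h] (by simp; omega)
      simp only [chainCost] at this
      have d3 := segCost_add_segCost L q Y hn1 (show l < h by omega) (show h < t₃ by omega)
      have a3 := hanti (show l + e ≤ h by omega) hh
      have := sq_nonneg (cusum Y l h t₃)
      linarith

/-- If no point of the estimate is within distance `d` of a jump, then the energy of the jump at
scale `d` is low. -/
theorem mul_sq_jump_le (hmin : IsPenalizedLSE L q (fun i => θ i + ε i) τ)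
    (hε : NoiseBound ε q) (hq : 0 ≤ q) (hL : 10 ^ 8 ≤ L) {v s w : ℕ} {r₁ r₂ d : ℝ} (hv : 1 ≤ v)
    (hvs : v < s) (hsw : s < w) (hw : w ≤ n + 1) (hθ₁ : ConstOn θ r₁ v s)
    (hθ₂ : ConstOn θ r₂ s w) (hd : 0 < d) (hdl : d ≤ ((s : ℝ) - v) / 2)
    (hdr : d ≤ ((w : ℝ) - s) / 2) (hfar : ∀ t ∈ τ, d < |(t : ℝ) - s|) :
    d * (r₂ - r₁) ^ 2 ≤ 16 * L * thresholdSq n q (d / 2) (d / 2) := by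
  have hsτ : s ∉ τ := fun h => by
    have := hfar s h
    rw [sub_self, abs_zero] at this
    linarith
  obtain ⟨t₁, t₃, hc, h₁, h₃⟩ := exists_consec hmin.1 (Finset.mem_Icc.2 ⟨by omega, by omega⟩) hsτ
  have ht₁ := hc.one_le hmin.1
  have ht₃ := hc.le_succ hmin.1
  have hn : (0 : ℝ) < n := by exact_mod_cast (by omega : 0 < n)
  have hvs' : (v : ℝ) < s := by exact_mod_cast hvs
  have hsw' : (s : ℝ) < w := by exact_mod_cast hsw
  have hdt₁ : d < (s : ℝ) - t₁ := by
    rcases Finset.mem_insert.1 hc.left with h | h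
    · have : (t₁ : ℝ) ≤ v := by exact_mod_cast (by omega : t₁ ≤ v)
      linarith
    · have := hfar t₁ h
      rwa [abs_sub_comm, abs_of_pos (by simpa using h₁)] at this
  have hdt₃ : d < (t₃ : ℝ) - s := by
    rcases Finset.mem_insert.1 hc.right with h | h
    · have : (w : ℝ) ≤ t₃ := by exact_mod_cast (by omega : w ≤ t₃)
      linarith
    · have := hfar t₃ h
      rwa [abs_of_pos (by simpa using h₃)] at this
  -- The integer scale is at least `1`, so that segments are nonempty, and `2 * e` is at least `d`
  -- even when `d < 1`.
  obtain ⟨e, he⟩ : ∃ e, e = max 1 ⌊d⌋₊ := ⟨_, rfl⟩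
  have hfloor := Nat.floor_le hd.le
  have hfloor' := Nat.lt_floor_add_one d
  have he1 : 1 ≤ e := he ▸ le_max_left _ _
  have hed : d ≤ 2 * (e : ℝ) := by
    have h1 : (⌊d⌋₊ : ℝ) ≤ e := by exact_mod_cast (he ▸ le_max_right _ _ : ⌊d⌋₊ ≤ e)
    have h2 : (1 : ℝ) ≤ e := by exact_mod_cast he1
    linarith
  have hfl : 2 * ⌊d⌋₊ + v ≤ s := by
    have : 2 * (⌊d⌋₊ : ℝ) + v ≤ s := by linarith
    exact_mod_cast this
  have hfr : 2 * ⌊d⌋₊ + s ≤ w := by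
    have : 2 * (⌊d⌋₊ : ℝ) + s ≤ w := by linarith
    exact_mod_cast this
  have hft₁ : ⌊d⌋₊ + t₁ ≤ s := by
    have : (⌊d⌋₊ : ℝ) + t₁ ≤ s := by linarith
    exact_mod_cast this
  have hft₃ : ⌊d⌋₊ + s ≤ t₃ := by
    have : (⌊d⌋₊ : ℝ) + s ≤ t₃ := by linarith
    exact_mod_cast this
  -- Cutting at `s - e` is allowed only if it leaves a segment of length at least `e` after `t₁`;
  -- otherwise `t₁` itself is used. As `d` is at most half the distance to `v`, the choice never
  -- passes `v`, and the signal has a single jump on `[l, h)`.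
  obtain ⟨l, hl⟩ : ∃ l, l = if s < t₁ + 2 * e then t₁ else s - e := ⟨_, rfl⟩
  obtain ⟨h, hh⟩ : ∃ h, h = if t₃ < s + 2 * e then t₃ else s + e := ⟨_, rfl⟩
  have hl1 : (l = t₁ ∨ t₁ + e ≤ l) ∧ l + e ≤ s ∧ v ≤ l ∧ 1 ≤ l := by
    split_ifs at hl <;> omega
  have hh1 : (h = t₃ ∨ h + e ≤ t₃) ∧ s + e ≤ h ∧ h ≤ w := by
    split_ifs at hh <;> omega
  have hY := sq_cusum_le_of_refine hmin (by linarith) hq hc he1 hl1.1 hl1.2.1 hh1.2.1 hh1.1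
  have hls : l < s := by omega
  have hsh : s < h := by omega
  have hsig := sq_cusum_signal_le (θ := θ) hε hq (by omega) hls hsh (by omega)
  rw [sq_cusum_of_jump (by omega) hls hsh (by omega) (hθ₁.mono hl1.2.2.1 le_rfl)
    (hθ₂.mono le_rfl hh1.2.2)] at hsig
  have he0 : (0 : ℝ) < e := by exact_mod_cast he1
  have hx : (e : ℝ) ≤ (s : ℝ) - l := by
    have : (l : ℝ) + e ≤ s := by exact_mod_cast hl1.2.1
    linarith
  have hy : (e : ℝ) ≤ (h : ℝ) - s := by
    have : (s : ℝ) + e ≤ h := by exact_mod_cast hh1.2.1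
    linarith
  have hmono := mul_div_add_mono he0 he0 hx hy
  rw [show (e : ℝ) * e / (e + e) = e / 2 by field_simp; ring] at hmono
  have hanti := thresholdSq_anti (q := q) hn he0 he0 hx hy
  have hanti' := thresholdSq_anti (q := q) hn (x := d / 2) (y := d / 2) (by linarith) (by linarith)
    (show d / 2 ≤ e by linarith) (show d / 2 ≤ e by linarith)
  have hψ0 : 0 ≤ thresholdSq n q e e :=
    hq.trans ((le_thresholdSq q (by omega) hls hsh (by omega)).trans hanti)
  have h1 : (r₂ - r₁) ^ 2 * (e / 2) ≤ 4 * L * thresholdSq n q e e := by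
    have := mul_le_mul_of_nonneg_left hmono (sq_nonneg (r₂ - r₁))
    nlinarith
  have h2 : d * (r₂ - r₁) ^ 2 ≤ 2 * e * (r₂ - r₁) ^ 2 :=
    mul_le_mul_of_nonneg_right hed (sq_nonneg _)
  have h3 : 16 * L * thresholdSq n q e e ≤ 16 * L * thresholdSq n q (d / 2) (d / 2) :=
    mul_le_mul_of_nonneg_left hanti' (by linarith)
  linarith

/-- The estimate detects all high-energy change-points, on the noise event. -/
theorem detec_of_isPenalizedLSE (hθ : HasChangePoints θ K τs μ)
    (hmin : IsPenalizedLSE L q (fun i => θ i + ε i) τ) (hε : NoiseBound ε q) (hq : 10 ^ 9 ≤ q)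
    (hL : 10 ^ 8 ≤ L) : Detec θ K τs μ (64 * L) q (64 * L) τ := by
  intro k hk hhigh
  have hvs := hθ.lt_left hk
  have hsw := hθ.lt_right hk
  have hk' := Finset.mem_Icc.1 hk
  have hv := hθ.one_le (j := k - 1) (by omega)
  have hw := hθ.le_succ (j := k + 1) (by omega)
  have hc₁ := hθ.constOn_left hk
  have hc₂ := hθ.constOn_right hk
  set v := τs (k - 1)
  set s := τs k
  set w := τs (k + 1)
  set Δ := μ (k + 1) - μ k with hΔ
  have hn : (0 : ℝ) < n := by exact_mod_cast (by omega : 0 < n)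
  have hx : (0 : ℝ) < (s : ℝ) - v := by simpa using hvs
  have hy : (0 : ℝ) < (w : ℝ) - s := by simpa using hsw
  have hΔ0 : 0 < Δ ^ 2 := by
    have : Δ ≠ 0 := sub_ne_zero.2 (hθ.ne_succ k hk).symm
    positivity
  have hψ := le_thresholdSq q hv hvs hsw hw
  have hψ₁ : scale n q ((s : ℝ) - v) ≤ thresholdSq n q ((s : ℝ) - v) ((w : ℝ) - s) := by
    rw [thresholdSq_comm]
    exact scale_le_thresholdSq hn hy hx
  have hψ₂ := scale_le_thresholdSq (q := q) hn hx hy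
  have hxn : (s : ℝ) - v ≤ n := by
    have : (s : ℝ) ≤ n + v := by exact_mod_cast (by omega : s ≤ n + v)
    linarith
  have hyn : (w : ℝ) - s ≤ n := by
    have : (w : ℝ) ≤ n + s := by exact_mod_cast (by omega : w ≤ n + s)
    linarith
  have hE : (64 * L) ^ 2 * thresholdSq n q ((s : ℝ) - v) ((w : ℝ) - s) <
      Δ ^ 2 * (((s : ℝ) - v) * ((w : ℝ) - s) / ((s : ℝ) - v + ((w : ℝ) - s))) := by
    rw [← sq_cusum_of_jump hv hvs hsw hw hc₁ hc₂, ← sq_abs (cusum _ _ _ _),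
      ← Real.sq_sqrt (show 0 ≤ thresholdSq n q ((s : ℝ) - v) ((w : ℝ) - s) by linarith), ← mul_pow]
    unfold IsHighEnergy energy at hhigh
    rw [threshold_eq] at hhigh
    exact pow_lt_pow_left₀ hhigh (by positivity) two_ne_zero
  have hle₁ : ((s : ℝ) - v) * ((w : ℝ) - s) / ((s : ℝ) - v + ((w : ℝ) - s)) ≤ (s : ℝ) - v := by
    rw [div_le_iff₀ (by linarith)]
    nlinarith
  have hle₂ : ((s : ℝ) - v) * ((w : ℝ) - s) / ((s : ℝ) - v + ((w : ℝ) - s)) ≤ (w : ℝ) - s := by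
    rw [div_le_iff₀ (by linarith)]
    nlinarith
  have hE₁ := hE.trans_le (mul_le_mul_of_nonneg_left hle₁ hΔ0.le)
  have hE₂ := hE.trans_le (mul_le_mul_of_nonneg_left hle₂ hΔ0.le)
  have hκ : 64 * L ≤ (64 * L) ^ 2 := by nlinarith
  -- High energy forces `Δ ^ 2` times a segment length, itself at most `n`, to be large. Hence the
  -- logarithm in the detection radius is nonnegative.
  have hnΔ : 1 ≤ n * Δ ^ 2 := by nlinarith
  have hlog := Real.log_nonneg hnΔ
  set ℓ := Real.log (n * Δ ^ 2) with hℓ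
  set d₃ := 64 * L * (ℓ + q) / Δ ^ 2 with hd₃
  have hd₃0 : 0 < d₃ := by
    rw [hd₃]
    have : 0 < L := by linarith
    have : 0 < ℓ + q := by linarith
    positivity
  by_contra hcon
  push Not at hcon
  have hd0 : 0 < min (((w : ℝ) - s) / 2) (min (((s : ℝ) - v) / 2) d₃) :=
    lt_min (by linarith) (lt_min (by linarith) hd₃0)
  have key := mul_sq_jump_le hmin hε (by linarith) hL hv hvs hsw hw hc₁ hc₂ hd0
    ((min_le_right _ _).trans (min_le_left _ _)) (min_le_left _ _) hcon
  rw [← hΔ] at key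
  -- the case where the bound is one half of the length `g` of a neighbouring segment
  have hhalf : ∀ g : ℝ, 0 < g → g ≤ n →
      scale n q g ≤ thresholdSq n q ((s : ℝ) - v) ((w : ℝ) - s) →
      (64 * L) ^ 2 * thresholdSq n q ((s : ℝ) - v) ((w : ℝ) - s) < Δ ^ 2 * g →
      g / 2 * Δ ^ 2 ≤ 16 * L * thresholdSq n q (g / 2 / 2) (g / 2 / 2) → False := by
    intro g hg hgn hgψ hgE hgk
    have h1 : thresholdSq n q (g / 2 / 2) (g / 2 / 2) ≤ scale n q g + 2 * 8 := by
      refine thresholdSq_le_scale_add hn (by linarith) (by linarith) hg (le_of_eq ?_)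
      field_simp
      norm_num
    have h2 := le_scale (q := q) hg hgn
    have h3 : 16 * L * thresholdSq n q (g / 2 / 2) (g / 2 / 2) ≤ 16 * L * (2 * scale n q g) :=
      mul_le_mul_of_nonneg_left (by linarith) (by linarith)
    have h4 : (64 * L) * scale n q g ≤
        (64 * L) ^ 2 * thresholdSq n q ((s : ℝ) - v) ((w : ℝ) - s) :=
      mul_le_mul hκ hgψ (by linarith) (by positivity)
    linarith
  rcases min_choice (((w : ℝ) - s) / 2) (min (((s : ℝ) - v) / 2) d₃) with h | h
  · rw [h] at key
    exact hhalf _ hy hyn hψ₂ hE₂ key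
  rcases min_choice (((s : ℝ) - v) / 2) d₃ with h' | h'
  · rw [h, h'] at key
    exact hhalf _ hx hxn hψ₁ hE₁ key
  · rw [h, h'] at key
    have h1 : d₃ * Δ ^ 2 = 64 * L * (ℓ + q) := div_mul_cancel₀ _ hΔ0.ne'
    have h2 : thresholdSq n q (d₃ / 2) (d₃ / 2) ≤ 2 * ℓ + q := by
      unfold thresholdSq
      -- The argument is `4 * n / d₃`, and `d₃ * Δ ^ 2 = 64 * L * (ℓ + q)` is much larger than `4`.
      have : Real.log (n * (d₃ / 2 + d₃ / 2) / (d₃ / 2 * (d₃ / 2))) ≤ ℓ := by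
        refine Real.log_le_log (by positivity) ?_
        rw [show (n : ℝ) * (d₃ / 2 + d₃ / 2) / (d₃ / 2 * (d₃ / 2)) = n * (4 / d₃) by
          field_simp; ring]
        refine mul_le_mul_of_nonneg_left ?_ hn.le
        rw [div_le_iff₀ hd₃0, mul_comm, h1]
        nlinarith
      linarith
    have h3 : 16 * L * thresholdSq n q (d₃ / 2) (d₃ / 2) ≤ 16 * L * (2 * ℓ + q) :=
      mul_le_mul_of_nonneg_left h2 (by linarith)
    have h4 : 0 < L * (ℓ + q) := mul_pos (by linarith) (by linarith)
    have h5 : 0 ≤ L * q := mul_nonneg (by linarith) (by linarith)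
    linarith

end Deterministic

/-! ### Chaining: from a dyadic grid to all segments -/

section Chaining

variable {n : ℕ} {q : ℝ} {x : Fin n → ℝ}

/-- The sums of `x` over short unions of dyadic segments are controlled. -/
def GridBound (x : Fin n → ℝ) (q : ℝ) : Prop :=
  ∀ j i m : ℕ, 2 ^ j ≤ n → m ≤ 2 ^ 18 →
    |segSum x (i * 2 ^ j) ((i + m) * 2 ^ j)| ≤
      √((m : ℝ) * 2 ^ j * (1.5 * scale n q (2 ^ j)))

theorem scale_le_scale_add {n q y z : ℝ} (hn : 0 < n) (hy : 0 < y) (hz : 0 < z) :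
    scale n q y ≤ scale n q z + 2 * (1 + z / y) := by
  refine (scale_le_thresholdSq hn hz hy).trans (thresholdSq_le_scale_add hn hz hy hz ?_)
  rw [div_self hz.ne']

/-- The sum over any initial piece of a dyadic segment. -/
theorem GridBound.abs_segSum_prefix_le (hx : GridBound x q) (hq : 10 ^ 6 ≤ q) (j : ℕ) :
    2 ^ j ≤ n → ∀ i l : ℕ, l ≤ 2 ^ j →
      |segSum x (i * 2 ^ j) (i * 2 ^ j + l)| ≤ 10 * √(2 ^ j * (1.5 * scale n q (2 ^ j))) := by
  induction j with
  | zero =>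
    intro hn i l hl
    rw [pow_zero] at hl
    rcases Nat.le_one_iff_eq_zero_or_eq_one.1 hl with rfl | rfl
    · rw [add_zero, segSum_self, abs_zero]
      positivity
    · have := hx 0 i 1 hn (by norm_num)
      simp only [pow_zero, mul_one, Nat.cast_one, one_mul] at this ⊢
      have := Real.sqrt_nonneg (1.5 * scale n q 1)
      linarith
  | succ j ih =>
    intro hn i l hl
    have hn' : 2 ^ j ≤ n := le_trans (Nat.pow_le_pow_right (by norm_num) (Nat.le_succ j)) hn
    have hn0 : (0 : ℝ) < n := by exact_mod_cast (Nat.two_pow_pos j).trans_le hn'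
    have hs : q ≤ scale n q (2 ^ (j + 1)) := le_scale (by positivity) (by exact_mod_cast hn)
    have hs' := scale_le_scale_add (q := q) hn0 (y := 2 ^ j) (z := 2 ^ (j + 1)) (by positivity)
      (by positivity)
    rw [show (2 : ℝ) ^ (j + 1) / 2 ^ j = 2 by rw [pow_succ]; field_simp] at hs'
    -- A prefix at level `j + 1` is at most one full half, with constant `1`, plus a prefix at level
    -- `j`, with constant `10`. The recursion closes because `11 < 10 * √2`.
    have hstep : 11 * √(2 ^ j * (1.5 * scale n q (2 ^ j))) ≤
        10 * √(2 ^ (j + 1) * (1.5 * scale n q (2 ^ (j + 1)))) := by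
      rw [show (11 : ℝ) = √(11 ^ 2) by rw [Real.sqrt_sq (by norm_num)],
        show (10 : ℝ) = √(10 ^ 2) by rw [Real.sqrt_sq (by norm_num)],
        ← Real.sqrt_mul (by norm_num), ← Real.sqrt_mul (by norm_num)]
      refine Real.sqrt_le_sqrt ?_
      calc 11 ^ 2 * (2 ^ j * (1.5 * scale n q (2 ^ j)))
          = 2 ^ j * (11 ^ 2 * (1.5 * scale n q (2 ^ j))) := by ring
        _ ≤ 2 ^ j * (10 ^ 2 * (2 * (1.5 * scale n q (2 ^ (j + 1))))) :=
            mul_le_mul_of_nonneg_left (by linarith) (by positivity)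
        _ = 10 ^ 2 * (2 ^ (j + 1) * (1.5 * scale n q (2 ^ (j + 1)))) := by ring
    have hnn := Real.sqrt_nonneg (2 ^ j * (1.5 * scale n q (2 ^ j)))
    have hi : i * 2 ^ (j + 1) = 2 * i * 2 ^ j := by ring
    rw [hi]
    rcases le_total l (2 ^ j) with hlj | hlj
    · have := ih hn' (2 * i) l hlj
      linarith
    · have h1 := ih hn' (2 * i + 1) (l - 2 ^ j) (by rw [pow_succ] at hl; omega)
      have h2 := hx j (2 * i) 1 hn' (by norm_num)
      rw [Nat.cast_one, one_mul] at h2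
      have hle : 2 * i * 2 ^ j ≤ (2 * i + 1) * 2 ^ j := Nat.mul_le_mul_right _ (by omega)
      have heq : (2 * i + 1) * 2 ^ j + (l - 2 ^ j) = 2 * i * 2 ^ j + l := by
        rw [add_mul, one_mul]
        omega
      have hadd := segSum_add_segSum x hle
        (show (2 * i + 1) * 2 ^ j ≤ (2 * i + 1) * 2 ^ j + (l - 2 ^ j) by omega)
      rw [heq] at hadd h1
      rw [← hadd]
      have := abs_add_le (segSum x (2 * i * 2 ^ j) ((2 * i + 1) * 2 ^ j))
        (segSum x ((2 * i + 1) * 2 ^ j) (2 * i * 2 ^ j + l))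
      linarith

/-- The sum over any segment. -/
theorem GridBound.abs_segSum_le (hx : GridBound x q) (hq : 10 ^ 9 ≤ q) {s e : ℕ} (hs : 1 ≤ s)
    (hse : s < e) (he : e ≤ n + 1) :
    |segSum x s e| ≤ √(2 * (((e : ℝ) - s) * scale n q ((e : ℝ) - s))) := by
  obtain ⟨a, rfl⟩ : ∃ a, e = s + a := ⟨e - s, by omega⟩
  have ha : 0 < a := by omega
  have han : a ≤ n := by omega
  have hn0 : (0 : ℝ) < n := by exact_mod_cast (by omega : 0 < n)
  have ha0 : (0 : ℝ) < a := by exact_mod_cast ha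
  rw [show ((s + a : ℕ) : ℝ) - s = a by push_cast; ring]
  have hsc : q ≤ scale n q a := le_scale ha0 (by exact_mod_cast han)
  -- Short segments belong to the grid at level `0`. For the others, the mesh `N` is taken between
  -- `a / 2 ^ 17` and `a / 2 ^ 16`: fine enough for the two end pieces to be negligible, coarse
  -- enough for at most `2 ^ 18` cells.
  rcases lt_or_ge a (2 ^ 16) with hlt | hge
  · have h := hx 0 s a (by rw [pow_zero]; omega) (by omega)
    simp only [pow_zero, mul_one] at h
    refine h.trans (Real.sqrt_le_sqrt ?_)
    have h1 := scale_le_scale_add (q := q) hn0 one_pos ha0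
    have h2 : (a : ℝ) ≤ 2 ^ 16 := by exact_mod_cast hlt.le
    rw [mul_left_comm (2 : ℝ)]
    refine mul_le_mul_of_nonneg_left ?_ ha0.le
    rw [div_one] at h1
    linarith
  · obtain ⟨j, hj⟩ : ∃ j, j = Nat.log 2 (a / 2 ^ 16) := ⟨_, rfl⟩
    have hj1 : 2 ^ j ≤ a / 2 ^ 16 := hj ▸ Nat.pow_log_le_self 2 (by omega)
    have hj2 : a / 2 ^ 16 < 2 ^ (j + 1) := hj ▸ Nat.lt_pow_succ_log_self (by norm_num) _
    obtain ⟨N, hN⟩ : ∃ N, N = 2 ^ j := ⟨_, rfl⟩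
    have hNR : (2 : ℝ) ^ j = N := by rw [hN]; push_cast; rfl
    rw [pow_succ 2 j, ← hN] at hj2
    rw [← hN] at hj1
    have hN0 : 0 < N := by rw [hN]; positivity
    have hNR0 : (0 : ℝ) < N := by exact_mod_cast hN0
    have hNn : N ≤ n := by omega
    have hds := Nat.div_add_mod s N
    have hde := Nat.div_add_mod (s + a) N
    have hms := Nat.mod_lt s hN0
    have hme := Nat.mod_lt (s + a) hN0
    set i := s / N with hi
    set i' := (s + a) / N with hi'
    have hii' : i ≤ i' := Nat.div_le_div_right (by omega)
    obtain ⟨m, hm⟩ : ∃ m, i' = i + m := ⟨i' - i, by omega⟩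
    rw [mul_comm] at hds hde
    have hmN : m * N ≤ a + N := by
      have : i' * N = i * N + m * N := by rw [hm]; ring
      omega
    have hm18 : m ≤ 2 ^ 18 := by
      by_contra hcon
      have : (2 ^ 18 + 1) * N ≤ m * N := Nat.mul_le_mul_right _ (by omega)
      omega
    have hmain := hx j i m (hN ▸ hNn) hm18
    have hp1 := hx.abs_segSum_prefix_le (by linarith) j (hN ▸ hNn) i (s % N) (hN ▸ hms.le)
    have hp2 := hx.abs_segSum_prefix_le (by linarith) j (hN ▸ hNn) i' ((s + a) % N)
      (hN ▸ hme.le)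
    rw [← hN, hNR] at hmain hp1 hp2
    rw [hds] at hp1
    rw [hde] at hp2
    rw [← hm] at hmain
    have e1 := segSum_add_segSum x (show i * N ≤ i' * N from Nat.mul_le_mul_right _ hii')
      (show i' * N ≤ s + a by omega)
    have e2 := segSum_add_segSum x (show i * N ≤ s by omega) (show s ≤ s + a by omega)
    have hNa : (N : ℝ) * 65536 ≤ a := by
      have : N * 65536 ≤ a := by omega
      exact_mod_cast this
    have haN : (a : ℝ) ≤ N * 131072 := by
      have : a ≤ N * 131072 := by omega
      exact_mod_cast this
    have hmN' : (m : ℝ) * N ≤ a + N := by exact_mod_cast hmN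
    have hscN := scale_le_scale_add (q := q) hn0 hNR0 ha0
    have hsc0 : 0 ≤ scale n q N := by
      have : q ≤ scale n q N := le_scale hNR0 (by exact_mod_cast hNn)
      linarith
    have haN' : (a : ℝ) / N ≤ 131072 := by
      rw [div_le_iff₀ hNR0]
      linarith
    set T := √(a * (1.5 * scale n q N)) with hT
    have hT0 : 0 ≤ T := Real.sqrt_nonneg _
    have hT2 : T ^ 2 = a * (1.5 * scale n q N) := Real.sq_sqrt (by positivity)
    have hmain' : √((m : ℝ) * N * (1.5 * scale n q N)) ≤ 1.001 * T := by
      refine Real.sqrt_le_iff.2 ⟨by positivity, ?_⟩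
      rw [mul_pow, hT2, ← mul_assoc (1.001 ^ 2 : ℝ)]
      refine mul_le_mul_of_nonneg_right ?_ (by linarith)
      linarith
    have hpre : 10 * √((N : ℝ) * (1.5 * scale n q N)) ≤ 10 / 256 * T := by
      have : √((N : ℝ) * (1.5 * scale n q N)) ≤ 1 / 256 * T := by
        refine Real.sqrt_le_iff.2 ⟨by positivity, ?_⟩
        rw [mul_pow, hT2, ← mul_assoc ((1 / 256) ^ 2 : ℝ)]
        refine mul_le_mul_of_nonneg_right ?_ (by linarith)
        linarith
      linarith
    have htot : |segSum x s (s + a)| ≤ 1.08 * T := by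
      have : segSum x s (s + a) = segSum x (i * N) (i' * N) + segSum x (i' * N) (s + a) -
          segSum x (i * N) s := by linarith
      rw [this]
      have h1 := abs_sub (segSum x (i * N) (i' * N) + segSum x (i' * N) (s + a))
        (segSum x (i * N) s)
      have h2 := abs_add_le (segSum x (i * N) (i' * N)) (segSum x (i' * N) (s + a))
      linarith
    -- The factor `1.08 ^ 2 * 1.5` is below `2`; the remaining slack, with `q` huge, absorbs the
    -- bounded difference between the scales at `N` and at `a`.
    refine htot.trans (Real.le_sqrt_of_sq_le ?_)
    rw [mul_pow, hT2, mul_left_comm, mul_left_comm (2 : ℝ)]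
    refine mul_le_mul_of_nonneg_left ?_ ha0.le
    linarith

/-- The squared CUSUM statistic is at most the sum of the normalized squared sums of its two
segments. Each is at most twice a scale, which the threshold dominates: the total factor `4` is the
square of the `2` in the noise event. -/
theorem GridBound.noiseBound (hx : GridBound x q) (hq : 10 ^ 9 ≤ q) : NoiseBound x q := by
  intro t₁ t t₃ h₀ h₁ h₃ h₄
  have hn : (0 : ℝ) < n := by exact_mod_cast (by omega : 0 < n)
  have hx0 : (0 : ℝ) < (t : ℝ) - t₁ := by simpa using h₁
  have hy0 : (0 : ℝ) < (t₃ : ℝ) - t := by simpa using h₃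
  have hψ := le_thresholdSq q h₀ h₁ h₃ h₄
  have b1 := hx.abs_segSum_le hq h₀ h₁ (by omega)
  have b2 := hx.abs_segSum_le hq (by omega) h₃ h₄
  have s1 : scale n q ((t : ℝ) - t₁) ≤ thresholdSq n q ((t : ℝ) - t₁) ((t₃ : ℝ) - t) := by
    rw [thresholdSq_comm]
    exact scale_le_thresholdSq hn hy0 hx0
  have s2 := scale_le_thresholdSq (q := q) hn hx0 hy0
  have p1 : 0 ≤ scale n q ((t : ℝ) - t₁) := by
    have := (scale_bounds (n := n) (q := q) (L := 1) (by linarith) one_pos h₀ h₁ (by omega)).1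
    linarith
  have p2 : 0 ≤ scale n q ((t₃ : ℝ) - t) := by
    have := (scale_bounds (n := n) (q := q) (L := 1) (by linarith) one_pos (by omega) h₃ h₄).1
    linarith
  rw [Real.le_sqrt (abs_nonneg _) (by positivity), sq_abs] at b1 b2
  -- With `L = 0` the segment costs reduce to minus the normalized squared sums.
  have d := segCost_add_segCost (n := n) 0 0 x (by omega) h₁ h₃
  unfold segCost at d
  have q1 : segSum x t₁ t ^ 2 / ((t : ℝ) - t₁) ≤ 2 * scale n q ((t : ℝ) - t₁) := by
    rw [div_le_iff₀ hx0]
    linarith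
  have q2 : segSum x t t₃ ^ 2 / ((t₃ : ℝ) - t) ≤ 2 * scale n q ((t₃ : ℝ) - t) := by
    rw [div_le_iff₀ hy0]
    linarith
  have q3 : 0 ≤ segSum x t₁ t₃ ^ 2 / ((t₃ : ℝ) - t₁) :=
    div_nonneg (sq_nonneg _) (by linarith)
  rw [threshold_eq]
  refine abs_le_of_sq_le_sq ?_ (by positivity)
  rw [mul_pow, Real.sq_sqrt (by linarith)]
  linarith

end Chaining

/-! ### The probability of the noise event -/

section Probability

variable {Ω : Type*} [MeasurableSpace Ω] {P : Measure Ω} {n : ℕ}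
  {ε : Fin n → Ω → ℝ} {q : ℝ}

theorem card_segment_le {n : ℕ} (a b : ℕ) :
    (Finset.univ.filter (fun i : Fin n => a ≤ (i : ℕ) + 1 ∧ (i : ℕ) + 1 < b)).card ≤ b - a := by
  rw [← Nat.card_Ico]
  refine Finset.card_le_card_of_injOn (fun i => (i : ℕ) + 1) ?_ ?_
  · intro i hi
    simpa using hi
  · intro i _ j _ h
    exact Fin.ext (by simpa using h)

theorem IsNoise.measurable_segSum (hε : IsNoise P ε) (a b : ℕ) :
    Measurable fun ω => segSum (fun i => ε i ω) a b := by
  unfold segSum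
  exact Finset.measurable_sum _ fun i _ => hε.measurable i

theorem IsNoise.measurableSet_noiseEvent (hε : IsNoise P ε) :
    MeasurableSet (noiseEvent ε q) := by
  have : noiseEvent ε q = ⋂ t₁ : ℕ, ⋂ t₂ : ℕ, ⋂ t₃ : ℕ, ⋂ _ : 1 ≤ t₁, ⋂ _ : t₁ < t₂,
      ⋂ _ : t₂ < t₃, ⋂ _ : t₃ ≤ n + 1,
      {ω | |cusum (fun i => ε i ω) t₁ t₂ t₃| ≤ 2 * threshold n q t₁ t₂ t₃} := by
    ext ω
    simp only [noiseEvent, Set.mem_ofPred_eq, Set.mem_iInter]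
  rw [this]
  refine .iInter fun t₁ => .iInter fun t₂ => .iInter fun t₃ => .iInter fun _ => .iInter fun _ =>
    .iInter fun _ => .iInter fun _ => measurableSet_le ?_ measurable_const
  have h1 := hε.measurable_segSum t₂ t₃
  have h2 := hε.measurable_segSum t₁ t₂
  have : Measurable fun ω => cusum (fun i => ε i ω) t₁ t₂ t₃ :=
    ((h1.div_const _).sub (h2.div_const _)).mul_const _
  exact this.abs

/-- The length is replaced by an upper bound because grid segments may stick out of the observation
times. -/
theorem IsNoise.measureReal_segSum_le [IsProbabilityMeasure P] (hε : IsNoise P ε) {a b : ℕ} {ℓ t : ℝ}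
    (hab : ((b - a : ℕ) : ℝ) ≤ ℓ) (ht : 0 ≤ t) :
    P.real {ω | t < |segSum (fun i => ε i ω) a b|} ≤ 2 * Real.exp (-t ^ 2 / (2 * ℓ)) := by
  set F := Finset.univ.filter (fun i : Fin n => a ≤ (i : ℕ) + 1 ∧ (i : ℕ) + 1 < b) with hF
  rcases F.eq_empty_or_nonempty with hE | hE
  · have : {ω | t < |segSum (fun i => ε i ω) a b|} = ∅ := by
      ext ω
      simp only [segSum, ← hF, hE, Finset.sum_empty, abs_zero, Set.mem_ofPred_eq,
        Set.mem_empty_iff_false, iff_false, not_lt]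
      exact ht
    rw [this, measureReal_empty]
    positivity
  · have hcard0 : (0 : ℝ) < F.card := by exact_mod_cast hE.card_pos
    have hcard : (F.card : ℝ) ≤ ℓ := le_trans (by exact_mod_cast card_segment_le a b) hab
    have hexp : Real.exp (-t ^ 2 / (2 * F.card)) ≤ Real.exp (-t ^ 2 / (2 * ℓ)) := by
      rw [Real.exp_le_exp, neg_div, neg_div, neg_le_neg_iff]
      exact div_le_div_of_nonneg_left (sq_nonneg t) (by linarith) (by linarith)
    have h1 := HasSubgaussianMGF.measure_sum_ge_le_of_iIndepFun hε.indep (s := F) (c := fun _ => 1)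
      (fun i _ => hε.subgaussian i) ht
    have h2 := HasSubgaussianMGF.measure_sum_ge_le_of_iIndepFun
      (X := fun i => -(ε i)) (μ := P)
      (hε.indep.comp (fun _ => fun y : ℝ => -y) (fun _ => measurable_neg)) (s := F)
      (c := fun _ => 1) (fun i _ => (hε.subgaussian i).neg) ht
    simp only [Finset.sum_const, nsmul_eq_mul, mul_one, NNReal.coe_natCast] at h1 h2
    have hsub : {ω | t < |segSum (fun i => ε i ω) a b|} ⊆
        {ω | t ≤ ∑ i ∈ F, ε i ω} ∪ {ω | t ≤ ∑ i ∈ F, (-(ε i)) ω} := by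
      intro ω hω
      simp only [Set.mem_union, Set.mem_ofPred_eq, Pi.neg_apply, Finset.sum_neg_distrib]
      rcases lt_abs.1 (show t < |segSum (fun i => ε i ω) a b| from hω) with h | h
      · exact Or.inl h.le
      · exact Or.inr h.le
    calc P.real {ω | t < |segSum (fun i => ε i ω) a b|}
        ≤ P.real ({ω | t ≤ ∑ i ∈ F, ε i ω} ∪ {ω | t ≤ ∑ i ∈ F, (-(ε i)) ω}) :=
          measureReal_mono hsub
      _ ≤ P.real {ω | t ≤ ∑ i ∈ F, ε i ω} + P.real {ω | t ≤ ∑ i ∈ F, (-(ε i)) ω} :=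
          measureReal_union_le _ _
      _ ≤ 2 * Real.exp (-t ^ 2 / (2 * ℓ)) := by linarith

theorem sum_sqrt_two_pow_le (J : ℕ) :
    ∑ j ∈ Finset.range (J + 1), (√2) ^ j ≤ 4 * (√2) ^ J := by
  have h2 : (4 : ℝ) ≤ 3 * √2 := by
    have : (4 / 3 : ℝ) ≤ √2 := Real.le_sqrt_of_sq_le (by norm_num)
    linarith
  induction J with
  | zero => norm_num
  | succ J ih =>
    rw [Finset.sum_range_succ]
    have : (0 : ℝ) ≤ (√2) ^ J := by positivity
    rw [pow_succ]
    nlinarith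

/-- The number of grid points at level `j`, times the probability of a deviation there. -/
theorem level_bound {n j : ℕ} (q : ℝ) (hj : 2 ^ j ≤ n) :
    ((n / 2 ^ j + 1 : ℕ) : ℝ) * Real.exp (-(0.75 * scale n q (2 ^ j))) ≤
      2 * Real.exp (-(3 / 4 * q)) * ((√2) ^ j / √n) := by
  have hn0 : (0 : ℝ) < n := by exact_mod_cast (Nat.two_pow_pos j).trans_le hj
  have hj' : (2 : ℝ) ^ j ≤ n := by exact_mod_cast hj
  have hρ : (0 : ℝ) < n / 2 ^ j := by positivity
  have h1 : ((n / 2 ^ j + 1 : ℕ) : ℝ) ≤ 2 * (n / 2 ^ j) := by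
    have h : ((n / 2 ^ j : ℕ) : ℝ) ≤ n / 2 ^ j := by
      have := @Nat.cast_div_le ℝ _ _ _ n (2 ^ j)
      simpa using this
    have : (1 : ℝ) ≤ n / 2 ^ j := by rwa [le_div_iff₀ (by positivity), one_mul]
    push_cast
    linarith
  have h2 : Real.exp (-(0.75 * scale n q (2 ^ j))) =
      Real.exp (-(3 / 4 * q)) * Real.exp (-(3 / 2 * Real.log (n / 2 ^ j))) := by
    rw [← Real.exp_add]
    unfold scale
    congr 1
    ring
  -- The number of positions at level `j` meets a probability with exponent `3 / 2`. The product `(n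
  -- / 2 ^ j) ^ (-1/2)` is a geometric progression in `j`, dominated by the coarsest level.
  have h3 : (n : ℝ) / 2 ^ j * Real.exp (-(3 / 2 * Real.log (n / 2 ^ j))) = (√2) ^ j / √n := by
    calc (n : ℝ) / 2 ^ j * Real.exp (-(3 / 2 * Real.log (n / 2 ^ j)))
        = Real.exp (Real.log (n / 2 ^ j)) * Real.exp (-(3 / 2 * Real.log (n / 2 ^ j))) := by
          rw [Real.exp_log hρ]
      _ = (Real.exp (Real.log (n / 2 ^ j) / 2))⁻¹ := by
          rw [← Real.exp_add, ← Real.exp_neg]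
          congr 1
          ring
      _ = (√(n / 2 ^ j))⁻¹ := by rw [Real.exp_half, Real.exp_log hρ]
      _ = (√2) ^ j / √n := by
          rw [Real.sqrt_div hn0.le, inv_div]
          congr 1
          rw [Real.sqrt_eq_iff_mul_self_eq (by positivity) (by positivity), ← mul_pow,
            Real.mul_self_sqrt (by norm_num)]
  calc ((n / 2 ^ j + 1 : ℕ) : ℝ) * Real.exp (-(0.75 * scale n q (2 ^ j)))
      ≤ 2 * (n / 2 ^ j) * Real.exp (-(0.75 * scale n q (2 ^ j))) :=
        mul_le_mul_of_nonneg_right h1 (Real.exp_pos _).le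
    _ = 2 * Real.exp (-(3 / 4 * q)) *
        (n / 2 ^ j * Real.exp (-(3 / 2 * Real.log (n / 2 ^ j)))) := by
        rw [h2]
        ring
    _ = _ := by rw [h3]

/-- The constant is `2 ^ 18` values of `m`, times `2` for the two tails, times `2` for rounding the
number of positions, times `4` for the geometric sum over levels. -/
theorem IsNoise.le_measureReal_noiseEvent [IsProbabilityMeasure P] (hε : IsNoise P ε)
    (hn : 0 < n) (hq : 10 ^ 9 ≤ q) :
    1 - 2 ^ 22 * Real.exp (-(3 / 4) * q) ≤ P.real (noiseEvent ε q) := by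
  have hn0 : (0 : ℝ) < n := by exact_mod_cast hn
  set J := Nat.log 2 n with hJ
  have hJn : 2 ^ J ≤ n := Nat.pow_log_le_self 2 (by omega)
  set B : ℕ → ℕ → ℕ → Set Ω := fun j i m =>
    {ω | √((m : ℝ) * 2 ^ j * (1.5 * scale n q (2 ^ j))) <
      |segSum (fun i => ε i ω) (i * 2 ^ j) ((i + m) * 2 ^ j)|} with hB
  set U : Set Ω := ⋃ j ∈ Finset.range (J + 1), ⋃ i ∈ Finset.range (n / 2 ^ j + 1),
    ⋃ m ∈ Finset.Icc 1 (2 ^ 18), B j i m with hU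
  have hsub : (noiseEvent ε q)ᶜ ⊆ U := by
    intro ω hω
    by_contra hωU
    refine hω (GridBound.noiseBound (x := fun i => ε i ω) ?_ hq)
    intro j i m hj hm
    rcases Nat.eq_zero_or_pos m with rfl | hm0
    · rw [add_zero, segSum_self, abs_zero]
      positivity
    rcases lt_or_ge (n / 2 ^ j) i with hi | hi
    · have hlt : n < i * 2 ^ j := by
        rw [Nat.div_lt_iff_lt_mul (Nat.two_pow_pos j)] at hi
        exact hi
      have : segSum (fun i => ε i ω) (i * 2 ^ j) ((i + m) * 2 ^ j) = 0 := by
        unfold segSum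
        rw [Finset.filter_false_of_mem, Finset.sum_empty]
        intro l _
        have := l.2
        omega
      rw [this, abs_zero]
      positivity
    · by_contra hcon
      refine hωU ?_
      simp only [hU, Set.mem_iUnion]
      refine ⟨j, Finset.mem_range.2 ?_, i, Finset.mem_range.2 (by omega), m,
        Finset.mem_Icc.2 ⟨hm0, hm⟩, not_le.1 hcon⟩
      exact Nat.lt_succ_of_le (Nat.le_log_of_pow_le (by norm_num) hj)
  have hBle : ∀ j ∈ Finset.range (J + 1), ∀ i, ∀ m ∈ Finset.Icc 1 (2 ^ 18),
      P.real (B j i m) ≤ 2 * Real.exp (-(0.75 * scale n q (2 ^ j))) := by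
    intro j hj i m hm
    rw [Finset.mem_Icc] at hm
    rw [Finset.mem_range] at hj
    have hjn : 2 ^ j ≤ n :=
      le_trans (Nat.pow_le_pow_right (by norm_num) (by omega)) hJn
    have hm0 : (0 : ℝ) < m := by exact_mod_cast hm.1
    have hs : q ≤ scale n q (2 ^ j) := le_scale (by positivity) (by exact_mod_cast hjn)
    have h := hε.measureReal_segSum_le (a := i * 2 ^ j) (b := (i + m) * 2 ^ j)
      (ℓ := (m : ℝ) * 2 ^ j)
      (by
        rw [← Nat.sub_mul, Nat.add_sub_cancel_left]
        push_cast
        exact le_rfl)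
      (Real.sqrt_nonneg ((m : ℝ) * 2 ^ j * (1.5 * scale n q (2 ^ j))))
    refine h.trans (le_of_eq ?_)
    rw [Real.sq_sqrt (mul_nonneg (by positivity) (by linarith))]
    congr 2
    field_simp
    ring
  have hUle : P.real U ≤ 2 ^ 22 * Real.exp (-(3 / 4) * q) := by
    calc P.real U ≤ ∑ j ∈ Finset.range (J + 1), ∑ i ∈ Finset.range (n / 2 ^ j + 1),
          ∑ m ∈ Finset.Icc 1 (2 ^ 18), P.real (B j i m) := by
          refine (measureReal_biUnion_finset_le _ _).trans (Finset.sum_le_sum fun j _ => ?_)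
          refine (measureReal_biUnion_finset_le _ _).trans (Finset.sum_le_sum fun i _ => ?_)
          exact measureReal_biUnion_finset_le _ _
      _ ≤ ∑ j ∈ Finset.range (J + 1), ∑ i ∈ Finset.range (n / 2 ^ j + 1),
          ∑ m ∈ Finset.Icc 1 (2 ^ 18), 2 * Real.exp (-(0.75 * scale n q (2 ^ j))) :=
          Finset.sum_le_sum fun j hj => Finset.sum_le_sum fun i _ => Finset.sum_le_sum fun m hm =>
            hBle j hj i m hm
      _ = ∑ j ∈ Finset.range (J + 1), 2 ^ 19 * (((n / 2 ^ j + 1 : ℕ) : ℝ) *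
          Real.exp (-(0.75 * scale n q (2 ^ j)))) := by
          refine Finset.sum_congr rfl fun j _ => ?_
          rw [Finset.sum_const, Finset.sum_const, Finset.card_range, Nat.card_Icc]
          simp only [nsmul_eq_mul]
          push_cast
          ring
      _ ≤ ∑ j ∈ Finset.range (J + 1), 2 ^ 19 *
          (2 * Real.exp (-(3 / 4 * q)) * ((√2) ^ j / √n)) := by
          refine Finset.sum_le_sum fun j hj => mul_le_mul_of_nonneg_left
            (level_bound q (le_trans (Nat.pow_le_pow_right (by norm_num) ?_) hJn)) (by norm_num)
          rw [Finset.mem_range] at hj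
          omega
      _ = 2 ^ 20 * Real.exp (-(3 / 4 * q)) / √n * ∑ j ∈ Finset.range (J + 1), (√2) ^ j := by
          rw [Finset.mul_sum]
          refine Finset.sum_congr rfl fun j _ => ?_
          ring
      _ ≤ 2 ^ 20 * Real.exp (-(3 / 4 * q)) / √n * (4 * √n) := by
          refine mul_le_mul_of_nonneg_left ((sum_sqrt_two_pow_le J).trans ?_) (by positivity)
          refine mul_le_mul_of_nonneg_left (Real.le_sqrt_of_sq_le ?_) (by norm_num)
          rw [← pow_mul, mul_comm, pow_mul, Real.sq_sqrt (by norm_num)]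
          exact_mod_cast hJn
      _ = 2 ^ 22 * Real.exp (-(3 / 4) * q) := by
          have : √(n : ℝ) ≠ 0 := (Real.sqrt_pos.2 hn0).ne'
          rw [neg_mul]
          field_simp
          norm_num
  have hcompl := probReal_compl_eq_one_sub (μ := P) (hε.measurableSet_noiseEvent (q := q))
  have hmono : P.real (noiseEvent ε q)ᶜ ≤ P.real U :=
    measureReal_mono hsub (measure_ne_top P U)
  linarith

end Probability

end ChangePoint

end

theorem proposition4 :
    ∃ c > (0 : ℝ), ∃ c' > (0 : ℝ), ∃ L₀ q₀ : ℝ, ∃ n₀ : ℕ,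
      ∀ L ≥ L₀, ∃ κ > (1 : ℝ), ∀ q > q₀, ∀ n > n₀,
      ∀ K > 0, ∀ (θ : Fin n → ℝ) (τs : ℕ → ℕ) (μ : ℕ → ℝ),
        ChangePoint.HasChangePoints θ K τs μ →
      ∀ {Ω : Type*} [MeasurableSpace Ω] (P : MeasureTheory.Measure Ω)
        [MeasureTheory.IsProbabilityMeasure P] (ε : Fin n → Ω → ℝ),
        ChangePoint.IsNoise P ε →
      MeasurableSet (ChangePoint.noiseEvent ε q) ∧
      1 - c * Real.exp (-c' * q) ≤ P.real (ChangePoint.noiseEvent ε q) ∧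
      ∀ ω ∈ ChangePoint.noiseEvent ε q, ∀ τ : Finset ℕ,
        ChangePoint.IsPenalizedLSE L q (fun i => θ i + ε i ω) τ →
        ChangePoint.NoSp K τs τ ∧
        ChangePoint.Detec θ K τs μ κ q κ τ ∧
        ∀ k ∈ Finset.Icc 1 K, τs k ∈ τ ∨
          ¬ ChangePoint.IsHighEnergyIn θ (√L + 2) q (insert (τs k) τ) (τs k) := by
  -- The threshold on `L` makes the noise negligible. The one on `q` absorbs the logarithms of
  -- bounded ratios of lengths, which go up to about `10 ^ 6`.
  refine ⟨2 ^ 22, by norm_num, 3 / 4, by norm_num, 10 ^ 8, 10 ^ 9, 0, fun L hL => ?_⟩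
  refine ⟨64 * L, by linarith, ?_⟩
  intro q hq n hn K _ θ τs μ hθ Ω _ P _ ε hε
  refine ⟨hε.measurableSet_noiseEvent, hε.le_measureReal_noiseEvent hn hq.le, ?_⟩
  intro ω hω τ hτ
  have hω : ChangePoint.NoiseBound (fun i => ε i ω) q := hω
  refine ⟨ChangePoint.noSp_of_isPenalizedLSE hθ hτ hω hq.le hL,
    ChangePoint.detec_of_isPenalizedLSE hθ hτ hω hq.le hL, fun k hk => ?_⟩
  by_cases hk' : τs k ∈ τ
  · exact Or.inl hk'
  · exact Or.inr (ChangePoint.not_isHighEnergyIn_of_isPenalizedLSE hτ hω (by linarith)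
      (hθ.mem_Icc hk) hk')
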